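/- Consider bond percolation on the square lattice $\mathbb{Z}^2$ (nearest neighbours joined by an edge): under $\mathbb{P}_p$, each edge is open with probability $p$, independently of all other edges. A $k$ by $\ell$ rectangle is a rectangle $R=[a,b]\times[c,d]$ with $a,b,c,d\in\mathbb{Z}$, $b-a=k$ and $d-c=\ell$, identified with the subgraph of $\mathbb{Z}^2$ induced by its lattice points (boundary included). Let $H(R)$ be the event that there is a path in $R$ consisting of open edges and joining a vertex on the left-hand side of $R$ to a vertex on the right-hand side. Let $1/2<p\le 1$ be fixed. If, for each $n$, $R_n$ is a $3n$ by $n$ rectangle, then $\mathbb{P}_p(H(R_n))\to 1$ as $n\to\infty$. -/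

import Mathlib

open MeasureTheory

namespace BondPercolation

/-- The planar square lattice `ℤ²`: nearest neighbours are joined by an edge. -/
def squareLattice : SimpleGraph (ℤ × ℤ) where
  Adj x y := |x.1 - y.1| + |x.2 - y.2| = 1
  symm := ⟨fun x y h => by rw [abs_sub_comm y.1, abs_sub_comm y.2]; exact h⟩
  loopless := ⟨fun x h => by simp at h⟩

/-- The bonds, that is, the edges of `ℤ²`. -/
abbrev Bond : Type := squareLattice.edgeSet

/-- A state `ω` of all the bonds; the bond `e` is open if `ω e = true` and closed if
`ω e = false`. The sigma-field is the product one, generated by the states of finitely many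
bonds. -/
abbrev Config : Type := Bond → Bool

/-- The law `P_p` of bond percolation: each bond is open with probability `p`, independently of
the others. -/
noncomputable def percMeasure (p : unitInterval) : Measure Config :=
  Measure.infinitePi fun _ : Bond => ProbabilityTheory.bernoulliMeasure true false p

/-- The integer data `a, b, c, d` of a rectangle `[a, b] × [c, d]`. -/
structure Rectangle where
  a : ℤ
  b : ℤ
  c : ℤ
  d : ℤ

namespace Rectangle

/-- `[a, b] × [c, d]` is a `k` by `l` rectangle if `b - a = k` and `d - c = l`. -/
def HasSize (R : Rectangle) (k l : ℕ) : Prop :=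
  R.b - R.a = k ∧ R.d - R.c = l

/-- The lattice points of the rectangle, boundary included. As a graph, the rectangle is the
subgraph of `ℤ²` that these points induce. -/
def verts (R : Rectangle) : Set (ℤ × ℤ) :=
  Set.Icc R.a R.b ×ˢ Set.Icc R.c R.d

/-- The event `H(R)` that `R` has a horizontal open crossing: there is a path in `R` consisting of
open bonds, from a vertex on the left-hand side of `R` to a vertex on the right-hand side. -/
def horizontalCrossing (R : Rectangle) : Set Config :=
  {ω | ∃ (u v : ℤ × ℤ) (w : squareLattice.Walk u v), w.IsPath ∧ u.1 = R.a ∧ v.1 = R.b ∧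
    (∀ x ∈ w.support, x ∈ R.verts) ∧ ∀ e : Bond, (e : Sym2 (ℤ × ℤ)) ∈ w.edges → ω e = true}

end Rectangle

end BondPercolation

/-!
Percolation at `1 - p < 1 / 2` decays exponentially, and a rectangle that is not crossed by an open
path from left to right is crossed from top to bottom by an open path of the dual configuration,
which has parameter `1 - p`. For a `3n` by `n` rectangle this dual path is an arm of length more
than `n` from one of `3n` faces, so the probability of no crossing is at most `3n` times an
exponentially small quantity (`exists_dual_crossing`, `one_sub_le_crossing`).

The decay below `1 / 2` is obtained without any Russo-Seymour-Welsh estimate, as follows. Let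
`φ_p(S)` be the expected number of open boundary edges of the finite set `S` whose end in `S` is
joined to the origin inside `S`. By the argument of Duminil-Copin and Tassion, if `φ_p(S) < 1` for
some `S`, then the one-arm probabilities decay exponentially at `p` (`exit_le_phi_mul`,
`tendsto_mul_theta`), while if `φ_p(S) ≥ 1` for all `S`, then a differential inequality bounds the
one-arm probabilities below at every larger parameter (`exit_lower_bound`).

Suppose that the second case holds at some `p < 1 / 2`. Then at all parameters between some
`p₁ < 1 / 2` and `1 - p₁`, hence for the configuration and for its dual, large squares are joined to
far away with probability close to one (`exists_setExit_ge`). As in Zhang's argument, by the square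
root trick a large square has with probability at least `1 / 2` an arm on each of its left and right
sides and a dual arm on each of its top and bottom sides (`sideArm_bound`). Changing the bonds near
the square yields a bond whose ends are joined to far away by two distinct clusters, with a
probability bounded below at all scales and for all parameters in `[p₁, 1 / 2]`
(`exists_twoArm_ge`). By Russo's formula, the expected number of clusters in the ball of radius `n`
that meet its boundary would then decrease along this interval at a rate of order `n ^ 2`, but this
number is at most of order `n` (`twoArm_sum_le`, `twoArm_not_bounded_below`).

The two facts of planar topology that are needed, that a dual path through a bond separates its ends
and that a rectangle without a crossing has a dual crossing, both follow from the exactness modulo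
two of the cochains of a rectangle (`exists_potential`).
-/

namespace BondPercolation

/-! ### Bernoulli product measures -/

section Bernoulli

open ProbabilityTheory

variable {ι κ : Type*}

/-- The law of a family of independent Bernoulli variables of parameter `p`. -/
noncomputable def bern (ι : Type*) (p : unitInterval) : Measure (ι → Bool) :=
  Measure.infinitePi fun _ : ι => bernoulliMeasure true false p

instance (p : unitInterval) : IsProbabilityMeasure (bern ι p) := by
  unfold bern; infer_instance

/-- The configurations that agree with the indicator of `s` on the coordinates in `I`. -/
def cyl (I s : Finset ι) : Set (ι → Bool) := {ω | ∀ e ∈ I, (ω e = true ↔ e ∈ s)}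

/-- The configuration whose set of open coordinates is `s`. -/
noncomputable def ind (s : Finset ι) : ι → Bool := by
  classical exact fun e => decide (e ∈ s)

@[simp] lemma ind_apply (s : Finset ι) (e : ι) : ind s e = true ↔ e ∈ s := by
  simp [ind]

lemma measurableSet_cyl (I s : Finset ι) : MeasurableSet (cyl I s) := by
  have : cyl I s = ⋂ e ∈ I, {ω : ι → Bool | ω e = true ↔ e ∈ s} := by
    ext ω; simp [cyl]
  rw [this]
  refine Finset.measurableSet_biInter _ fun e _ => ?_
  exact measurableSet_preimage (measurable_pi_apply (X := fun _ : ι => Bool) e)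
    (MeasurableSet.of_discrete (s := {b : Bool | b = true ↔ e ∈ s}))

lemma bern_real_cyl [DecidableEq ι] (p : unitInterval) (I s : Finset ι) (hs : s ⊆ I) :
    (bern ι p).real (cyl I s) = (p : ℝ) ^ s.card * (1 - p : ℝ) ^ (I \ s).card := by
  have h1 : cyl I s = Set.pi (I : Set ι) (fun e => {b : Bool | b = true ↔ e ∈ s}) := by
    ext ω; simp [cyl, Set.mem_pi]
  rw [h1, measureReal_def, bern, Measure.infinitePi_pi _ (fun _ _ => MeasurableSet.of_discrete),
    ENNReal.toReal_prod]
  have h2 : ∀ e ∈ I, (bernoulliMeasure true false p {b : Bool | b = true ↔ e ∈ s}).toReal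
      = if e ∈ s then (p : ℝ) else 1 - p := by
    intro e _
    rw [← measureReal_def]
    by_cases h : e ∈ s
    · rw [bernoulliMeasure_real_apply_of_mem_of_notMem] <;> simp [h]
    · rw [bernoulliMeasure_real_apply_of_notMem_of_mem] <;> simp [h]
  rw [Finset.prod_congr rfl h2, Finset.prod_ite, Finset.prod_const, Finset.prod_const]
  congr 3
  · ext e; simp only [Finset.mem_filter]; exact ⟨fun h => h.2, fun h => ⟨hs h, h⟩⟩
  · ext e; simp [Finset.mem_sdiff]

/-- A function of the coordinates in a finite set is a combination of cylinder indicators. -/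
lemma eq_sum_cyl [DecidableEq ι] {I : Finset ι} {g : (ι → Bool) → ℝ} (hg : DependsOn g (I : Set ι)) :
    g = fun ω => ∑ s ∈ I.powerset, (cyl I s).indicator (fun _ => g (ind s)) ω := by
  classical
  funext ω
  have hmem : ∀ s ∈ I.powerset, ω ∈ cyl I s ↔ s = I.filter fun e => ω e = true := by
    intro s hs
    rw [Finset.mem_powerset] at hs
    constructor
    · intro h; ext e
      simp only [Finset.mem_filter]
      exact ⟨fun he => ⟨hs he, (h e (hs he)).2 he⟩, fun he => (h e he.1).1 he.2⟩
    · rintro rfl e he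
      simp [he]
  rw [Finset.sum_eq_single (I.filter fun e => ω e = true)]
  · rw [Set.indicator_of_mem]
    · apply hg
      intro e he
      rw [Bool.eq_iff_iff, ind_apply]; simp [Finset.mem_coe.1 he]
    · rw [hmem _ (by simp)]
  · intro s hs hne
    rw [Set.indicator_of_notMem]
    rw [hmem s hs]; exact hne
  · intro h; exact absurd (by simp) h

lemma integrable_of_dependsOn {I : Finset ι} {g : (ι → Bool) → ℝ}
    (hg : DependsOn g (I : Set ι)) (p : unitInterval) : Integrable g (bern ι p) := by
  classical
  rw [eq_sum_cyl hg]
  exact integrable_finsetSum _ fun s _ =>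
    (integrable_const _).indicator (measurableSet_cyl I s)

lemma measurable_of_dependsOn {I : Finset ι} {g : (ι → Bool) → ℝ}
    (hg : DependsOn g (I : Set ι)) : Measurable g := by
  classical
  rw [eq_sum_cyl hg]
  exact Finset.measurable_sum _ fun s _ => measurable_const.indicator (measurableSet_cyl I s)

lemma mem_iff_of_dependsOn {A : Set (ι → Bool)} {I : Set ι} (hA : DependsOn (· ∈ A) I)
    {ω ω' : ι → Bool} (h : ∀ e ∈ I, ω e = ω' e) : ω ∈ A ↔ ω' ∈ A :=
  iff_of_eq (hA h)

lemma dependsOn_of_imp {A : Set (ι → Bool)} {I : Set ι}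
    (h : ∀ ω ω' : ι → Bool, (∀ e ∈ I, ω e = ω' e) → ω ∈ A → ω' ∈ A) : DependsOn (· ∈ A) I :=
  fun ω ω' hω => propext ⟨h ω ω' hω, h ω' ω fun e he => (hω e he).symm⟩

lemma dependsOn_compl {A : Set (ι → Bool)} {I : Set ι} (hA : DependsOn (· ∈ A) I) :
    DependsOn (· ∈ Aᶜ) I :=
  fun _ _ h => propext (not_congr (mem_iff_of_dependsOn hA h))

lemma dependsOn_inter {A B : Set (ι → Bool)} {I : Set ι} (hA : DependsOn (· ∈ A) I)
    (hB : DependsOn (· ∈ B) I) : DependsOn (· ∈ A ∩ B) I :=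
  fun _ _ h => propext (and_congr (mem_iff_of_dependsOn hA h) (mem_iff_of_dependsOn hB h))

lemma dependsOn_union {A B : Set (ι → Bool)} {I : Set ι} (hA : DependsOn (· ∈ A) I)
    (hB : DependsOn (· ∈ B) I) : DependsOn (· ∈ A ∪ B) I :=
  fun _ _ h => propext (or_congr (mem_iff_of_dependsOn hA h) (mem_iff_of_dependsOn hB h))

/-- The indicator function of an event. -/
noncomputable def one (A : Set (ι → Bool)) : (ι → Bool) → ℝ := A.indicator 1

lemma dependsOn_one {A : Set (ι → Bool)} {I : Set ι} (hA : DependsOn (· ∈ A) I) :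
    DependsOn (one A) I := by
  classical
  intro ω ω' h
  have := mem_iff_of_dependsOn hA h
  simp only [one, Set.indicator_apply, this, Pi.one_apply]

lemma measurableSet_of_dependsOn {I : Finset ι} {A : Set (ι → Bool)}
    (hA : DependsOn (· ∈ A) (I : Set ι)) : MeasurableSet A := by
  have : A = one A ⁻¹' {1} := by
    ext ω; by_cases h : ω ∈ A <;> simp [one, h]
  rw [this]
  exact measurable_of_dependsOn (dependsOn_one hA) (measurableSet_singleton 1)

/-- The expectation of `g` on the coordinates in `I`, as a polynomial in the parameter. -/
noncomputable def Ex [DecidableEq ι] (I : Finset ι) (p : ℝ) (g : (ι → Bool) → ℝ) : ℝ :=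
  ∑ s ∈ I.powerset, p ^ s.card * (1 - p) ^ (I \ s).card * g (ind s)

lemma integral_eq_Ex [DecidableEq ι] {I : Finset ι} {g : (ι → Bool) → ℝ}
    (hg : DependsOn g (I : Set ι)) (p : unitInterval) : ∫ ω, g ω ∂(bern ι p) = Ex I p g := by
  conv_lhs => rw [eq_sum_cyl hg]
  rw [integral_finsetSum _ fun s _ => (integrable_const _).indicator (measurableSet_cyl I s)]
  refine Finset.sum_congr rfl fun s hs => ?_
  rw [integral_indicator_const _ (measurableSet_cyl I s), smul_eq_mul,
    bern_real_cyl p I s (Finset.mem_powerset.1 hs)]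

lemma integral_one {A : Set (ι → Bool)} {I : Finset ι} (hA : DependsOn (· ∈ A) (I : Set ι))
    (p : unitInterval) : ∫ ω, one A ω ∂(bern ι p) = (bern ι p).real A :=
  integral_indicator_one (measurableSet_of_dependsOn hA)

lemma real_eq_Ex [DecidableEq ι] {A : Set (ι → Bool)} {I : Finset ι}
    (hA : DependsOn (· ∈ A) (I : Set ι)) (p : unitInterval) :
    (bern ι p).real A = Ex I p (one A) := by
  rw [← integral_one hA, integral_eq_Ex (dependsOn_one hA)]

lemma Ex_insert [DecidableEq ι] {J : Finset ι} {e : ι} (he : e ∉ J) (p : ℝ)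
    (g : (ι → Bool) → ℝ) :
    Ex (insert e J) p g = p * Ex J p (fun ω => g (Function.update ω e true))
      + (1 - p) * Ex J p (fun ω => g (Function.update ω e false)) := by
  have h1 : ∀ s ∈ J.powerset, Function.update (ind s) e false = ind s := by
    intro s hs
    have := fun h => he (Finset.mem_powerset.1 hs h)
    funext f
    by_cases hf : f = e
    · subst hf; simpa [ind] using this
    · simp [hf]
  have h2 : ∀ s ∈ J.powerset, Function.update (ind s) e true = ind (insert e s) := by
    intro s hs
    funext f
    by_cases hf : f = e
    · subst hf; simp [ind]
    · simp [hf, ind]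
  unfold Ex
  rw [Finset.sum_powerset_insert he, Finset.mul_sum, Finset.mul_sum, add_comm]
  congr 1
  · refine Finset.sum_congr rfl fun s hs => ?_
    have hes : e ∉ s := fun h => he (Finset.mem_powerset.1 hs h)
    simp only [h2 s hs]
    rw [Finset.card_insert_of_notMem hes, Finset.insert_sdiff_insert,
      Finset.sdiff_insert_of_notMem he]
    ring
  · refine Finset.sum_congr rfl fun s hs => ?_
    have hes : e ∉ s := fun h => he (Finset.mem_powerset.1 hs h)
    simp only [h1 s hs]
    rw [Finset.insert_sdiff_of_notMem _ hes,
      Finset.card_insert_of_notMem (by simp [he])]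
    ring

lemma Ex_empty [DecidableEq ι] (p : ℝ) (g : (ι → Bool) → ℝ) :
    Ex ∅ p g = g (ind ∅) := by simp [Ex]

lemma Ex_sub [DecidableEq ι] (I : Finset ι) (p : ℝ) (f g : (ι → Bool) → ℝ) :
    Ex I p (fun ω => f ω - g ω) = Ex I p f - Ex I p g := by
  simp only [Ex, mul_sub, Finset.sum_sub_distrib]

lemma Ex_mono [DecidableEq ι] (I : Finset ι) {p : ℝ} (hp0 : 0 ≤ p) (hp1 : p ≤ 1)
    {f g : (ι → Bool) → ℝ} (h : ∀ ω, f ω ≤ g ω) : Ex I p f ≤ Ex I p g := by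
  refine Finset.sum_le_sum fun s _ => mul_le_mul_of_nonneg_left (h _) ?_
  have : 0 ≤ 1 - p := by linarith
  positivity

/-- The effect of the coordinate `e` on `g`. -/
def influence [DecidableEq ι] (e : ι) (g : (ι → Bool) → ℝ) (ω : ι → Bool) : ℝ :=
  g (Function.update ω e true) - g (Function.update ω e false)

/-- **Harris' inequality** for the finite expectations. -/
lemma Ex_mul_le [DecidableEq ι] (I : Finset ι) {p : ℝ} (hp0 : 0 ≤ p) (hp1 : p ≤ 1)
    (f g : (ι → Bool) → ℝ) (hf : Monotone f) (hg : Monotone g) :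
    Ex I p f * Ex I p g ≤ Ex I p (fun ω => f ω * g ω) := by
  induction I using Finset.induction_on generalizing f g with
  | empty => simp [Ex_empty]
  | insert e J he ih =>
    have upd : ∀ b, Monotone fun ω : ι → Bool => Function.update ω e b := fun b ω ω' h =>
      update_le_update_iff.2 ⟨le_rfl, fun j _ => h j⟩
    have ht := ih _ _ (hf.comp (upd true)) (hg.comp (upd true))
    have hff := ih _ _ (hf.comp (upd false)) (hg.comp (upd false))
    have key : ∀ f : (ι → Bool) → ℝ, Monotone f →
        Ex J p (fun ω => f (Function.update ω e false)) ≤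
          Ex J p (fun ω => f (Function.update ω e true)) := fun f hf =>
      Ex_mono J hp0 hp1 fun ω => hf (update_le_update_iff.2 ⟨by simp, fun _ _ => le_rfl⟩)
    have kf := key f hf
    have kg := key g hg
    rw [Ex_insert he, Ex_insert he, Ex_insert he]
    simp only [Function.comp_def] at ht hff
    have h1 := mul_le_mul_of_nonneg_left ht hp0
    have h2 := mul_le_mul_of_nonneg_left hff (sub_nonneg.2 hp1)
    have h3 := mul_nonneg (mul_nonneg hp0 (sub_nonneg.2 hp1))
      (mul_nonneg (sub_nonneg.2 kf) (sub_nonneg.2 kg))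
    nlinarith [h1, h2, h3]

/-- **Russo's formula** for the finite expectations. -/
lemma hasDerivAt_Ex [DecidableEq ι] (I : Finset ι) (g : (ι → Bool) → ℝ) (p : ℝ) :
    HasDerivAt (fun p => Ex I p g) (∑ e ∈ I, Ex I p (influence e g)) p := by
  induction I using Finset.induction_on generalizing g with
  | empty => simpa [Ex_empty] using hasDerivAt_const p (g (ind ∅))
  | insert e J he ih =>
    have h1 := ih (fun ω => g (Function.update ω e true))
    have h2 := ih (fun ω => g (Function.update ω e false))
    have h3 := ((hasDerivAt_id p).mul h1).add (((hasDerivAt_id p).const_sub 1).mul h2)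
    have hfun : (fun p => Ex (insert e J) p g) = (id * fun p => Ex J p fun ω =>
        g (Function.update ω e true)) + (fun x => 1 - id x) * fun p => Ex J p fun ω =>
        g (Function.update ω e false) := by
      funext q; simp [Ex_insert he]
    rw [hfun]
    refine h3.congr_deriv ?_
    rw [Finset.sum_insert he]
    have h4 : Ex (insert e J) p (influence e g) = Ex J p (fun ω => g (Function.update ω e true))
        - Ex J p (fun ω => g (Function.update ω e false)) := by
      rw [Ex_insert he, ← Ex_sub]
      simp only [influence, Function.update_idem]
      ring
    have h5 : ∀ f ∈ J, Ex (insert e J) p (influence f g) =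
        p * Ex J p (influence f fun ω => g (Function.update ω e true))
        + (1 - p) * Ex J p (influence f fun ω => g (Function.update ω e false)) := by
      intro f hf
      have hne : f ≠ e := fun h => he (h ▸ hf)
      rw [Ex_insert he]
      have h6 : ∀ b, (fun ω => influence f g (Function.update ω e b)) =
          influence f fun ω => g (Function.update ω e b) := fun b => by
        funext ω
        simp only [influence, Function.update_comm hne]
      rw [h6, h6]
    rw [h4, Finset.sum_congr rfl h5, Finset.sum_add_distrib, Finset.mul_sum, Finset.mul_sum]
    simp only [id]
    ring

lemma dependsOn_influence [DecidableEq ι] {I : Set ι} {g : (ι → Bool) → ℝ} (hg : DependsOn g I)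
    (e : ι) : DependsOn (influence e g) I := by
  have : ∀ b, DependsOn (fun ω => g (Function.update ω e b)) I := by
    intro b ω ω' h
    apply hg
    intro i hi
    by_cases hie : i = e
    · subst hie; simp
    · simp [hie, h i hi]
  intro ω ω' h
  exact congrArg₂ (fun x y : ℝ => x - y) (this true h) (this false h)

lemma monotone_one {A : Set (ι → Bool)} (hA : IsUpperSet A) : Monotone (one A) := by
  intro ω ω' h
  by_cases hω : ω ∈ A
  · simp [one, hω, hA h hω]
  · simp only [one, Set.indicator_of_notMem hω]
    exact Set.indicator_nonneg (fun _ _ => zero_le_one) _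

/-- The probability of an increasing event is nondecreasing in the parameter. -/
lemma bern_mono {A : Set (ι → Bool)} {I : Finset ι} (hA : DependsOn (· ∈ A) (I : Set ι))
    (hup : IsUpperSet A) {p q : unitInterval} (hpq : p ≤ q) :
    (bern ι p).real A ≤ (bern ι q).real A := by
  classical
  rw [real_eq_Ex hA, real_eq_Ex hA]
  have hmono : MonotoneOn (fun p => Ex I p (one A)) (Set.Icc 0 1) := by
    refine monotoneOn_of_hasDerivWithinAt_nonneg (convex_Icc 0 1)
      (fun x _ => (hasDerivAt_Ex I (one A) x).continuousAt.continuousWithinAt)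
      (fun x _ => (hasDerivAt_Ex I (one A) x).hasDerivWithinAt) ?_
    intro x hx
    rw [interior_Icc] at hx
    refine Finset.sum_nonneg fun e _ => ?_
    have : (0 : ℝ) = Ex I x (fun _ => 0) := by simp [Ex]
    rw [this]
    refine Ex_mono I hx.1.le hx.2.le fun ω => ?_
    have hle : Function.update ω e false ≤ Function.update ω e true :=
      update_le_update_iff.2 ⟨by simp, fun _ _ => le_rfl⟩
    exact sub_nonneg.2 (monotone_one hup hle)
  exact hmono p.2 q.2 hpq

/-- **Harris' inequality** for two increasing events. -/
lemma harris {A B : Set (ι → Bool)} {I : Finset ι} (hA : DependsOn (· ∈ A) (I : Set ι))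
    (hB : DependsOn (· ∈ B) (I : Set ι)) (hAu : IsUpperSet A) (hBu : IsUpperSet B)
    (p : unitInterval) :
    (bern ι p).real A * (bern ι p).real B ≤ (bern ι p).real (A ∩ B) := by
  classical
  have hAB := dependsOn_inter hA hB
  rw [real_eq_Ex hA, real_eq_Ex hB, real_eq_Ex hAB]
  refine (Ex_mul_le I p.2.1 p.2.2 _ _ (monotone_one hAu) (monotone_one hBu)).trans_eq ?_
  congr 1
  funext ω
  simp only [one, Set.inter_indicator_one, Pi.mul_apply]

lemma bern_compl {A : Set (ι → Bool)} {I : Finset ι} (hA : DependsOn (· ∈ A) (I : Set ι))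
    (p : unitInterval) : (bern ι p).real Aᶜ = 1 - (bern ι p).real A :=
  probReal_compl_eq_one_sub (measurableSet_of_dependsOn hA)

/-- **Harris' inequality** for two decreasing events, given as complements. -/
lemma harris_compl {A B : Set (ι → Bool)} {I : Finset ι} (hA : DependsOn (· ∈ A) (I : Set ι))
    (hB : DependsOn (· ∈ B) (I : Set ι)) (hAu : IsUpperSet A) (hBu : IsUpperSet B)
    (p : unitInterval) :
    (bern ι p).real Aᶜ * (bern ι p).real Bᶜ ≤ (bern ι p).real (Aᶜ ∩ Bᶜ) := by
  have h1 := harris hA hB hAu hBu p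
  have h2 : (bern ι p).real (A ∪ B) + (bern ι p).real (A ∩ B) =
      (bern ι p).real A + (bern ι p).real B :=
    measureReal_union_add_inter (measurableSet_of_dependsOn hB)
  have hAB := dependsOn_union hA hB
  rw [← Set.compl_union, bern_compl hA, bern_compl hB, bern_compl hAB]
  nlinarith

/-- Events that depend on disjoint sets of coordinates are independent. -/
lemma bern_indep {A B : Set (ι → Bool)} {I J : Finset ι} (hIJ : Disjoint I J)
    (hA : DependsOn (· ∈ A) (I : Set ι)) (hB : DependsOn (· ∈ B) (J : Set ι)) (p : unitInterval) :
    (bern ι p).real (A ∩ B) = (bern ι p).real A * (bern ι p).real B := by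
  have hind : iIndepFun (fun (i : ι) (ω : ι → Bool) => ω i) (bern ι p) :=
    iIndepFun_infinitePi (Ω := fun _ : ι => Bool) (X := fun _ => id) (fun _ => measurable_id)
  have h := hind.indepFun_finset I J hIJ (fun i => measurable_pi_apply i)
  have pre : ∀ {A : Set (ι → Bool)} {I : Finset ι}, DependsOn (· ∈ A) (I : Set ι) →
      ∃ S : Set (I → Bool), A = (fun (ω : ι → Bool) (i : I) => ω i) ⁻¹' S := by
    intro A I hA
    refine ⟨(fun (ω : ι → Bool) (i : I) => ω i) '' A, ?_⟩
    ext ω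
    constructor
    · intro h; exact ⟨ω, h, rfl⟩
    · rintro ⟨ω', h', heq⟩
      have : (ω' ∈ A) = (ω ∈ A) := hA fun i hi => congrFun heq ⟨i, hi⟩
      exact this ▸ h'
  obtain ⟨S, rfl⟩ := pre hA
  obtain ⟨T, rfl⟩ := pre hB
  have := h.measure_inter_preimage_eq_mul S T MeasurableSet.of_discrete MeasurableSet.of_discrete
  simp only [measureReal_def]
  rw [this, ENNReal.toReal_mul]

lemma bern_iInter_indep {α : Type*} (s : Finset α) {A : α → Set (ι → Bool)} {I : α → Finset ι}
    (hI : Pairwise fun i j => Disjoint (I i) (I j)) (hA : ∀ i, DependsOn (· ∈ A i) (I i : Set ι))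
    (p : unitInterval) : (bern ι p).real (⋂ i ∈ s, A i) = ∏ i ∈ s, (bern ι p).real (A i) := by
  classical
  induction s using Finset.induction_on with
  | empty => simp
  | insert a s ha ih =>
    rw [Finset.set_biInter_insert, Finset.prod_insert ha, ← ih]
    refine bern_indep (J := s.biUnion I) ?_ (hA a) ?_ p
    · rw [Finset.disjoint_biUnion_right]
      exact fun i hi => hI fun h => ha (h ▸ hi)
    · refine dependsOn_of_imp fun ω ω' h hω => ?_
      simp only [Set.mem_iInter] at hω ⊢
      intro i hi
      refine (mem_iff_of_dependsOn (hA i) fun e he => h e ?_).1 (hω i hi)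
      exact Finset.mem_coe.2 (Finset.mem_biUnion.2 ⟨i, hi, he⟩)

/-- Replace the states of the coordinates in `M` by those of the configuration with open set `s`. -/
noncomputable def modify (M s : Finset ι) (ω : ι → Bool) : ι → Bool := by
  classical exact fun e => if e ∈ M then ind s e else ω e

/-- Changing the states of finitely many coordinates costs a constant factor in probability. -/
lemma modify_le {A : Set (ι → Bool)} {I M : Finset ι} (hA : DependsOn (· ∈ A) (I : Set ι))
    (s : Finset ι) (hs : s ⊆ M) (p : unitInterval) {q : ℝ} (hq : 0 ≤ q) (hqp : q ≤ p)
    (hqp' : q ≤ 1 - p) :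
    q ^ M.card * (bern ι p).real (modify M s ⁻¹' A) ≤ (bern ι p).real A := by
  classical
  have hB : DependsOn (· ∈ modify M s ⁻¹' A) ((I \ M : Finset ι) : Set ι) := by
    intro ω ω' h
    simp only [Set.mem_preimage]
    apply hA
    intro i hi
    by_cases hM : i ∈ M
    · simp [modify, hM]
    · simp only [modify, hM, if_false]
      exact h i (by simpa [hM] using hi)
  have hC : DependsOn (· ∈ cyl M s) (M : Set ι) := by
    intro ω ω' h
    simp only [cyl, Set.mem_ofPred_eq, eq_iff_iff]
    exact forall₂_congr fun e he => by rw [h e he]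
  have h1 := bern_indep Finset.disjoint_sdiff hC hB p
  rw [bern_real_cyl p M s hs] at h1
  have h2 : cyl M s ∩ modify M s ⁻¹' A ⊆ A := by
    rintro ω ⟨h, h'⟩
    have : modify M s ω = ω := by
      funext e
      by_cases he : e ∈ M
      · simp only [modify, he, if_true]
        rw [Bool.eq_iff_iff, ind_apply, h e he]
      · simp [modify, he]
    rwa [Set.mem_preimage, this] at h'
  refine le_trans ?_ (measureReal_mono h2)
  rw [h1]
  refine mul_le_mul_of_nonneg_right ?_ measureReal_nonneg
  have hcard : M.card = s.card + (M \ s).card := by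
    rw [Finset.card_sdiff_of_subset hs]; have := Finset.card_le_card hs; omega
  rw [hcard, pow_add]
  have := hq.trans hqp
  gcongr

/-- Relabelling the coordinates preserves the law. -/
lemma bern_map_reindex (p : unitInterval) (e : κ ≃ ι) :
    (bern ι p).map (fun ω k => ω (e k)) = bern κ p := by
  classical
  refine Measure.eq_infinitePi _ fun s t ht => ?_
  rw [Measure.map_apply (by fun_prop) (.pi s.countable_toSet fun _ _ => ht _)]
  have : (fun (ω : ι → Bool) k => ω (e k)) ⁻¹' (Set.pi (s : Set κ) t) =
      Set.pi ((s.map e.toEmbedding : Finset ι) : Set ι) fun i => t (e.symm i) := by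
    ext ω
    simp only [Set.mem_preimage, Set.mem_pi, Finset.mem_coe, Finset.mem_map_equiv]
    exact ⟨fun h i hi => by simpa using h _ hi, fun h k hk => by simpa using h (e k) (by simpa)⟩
  rw [this, bern, Measure.infinitePi_pi _ fun i _ => ht _]
  simp

/-- Exchanging open and closed replaces `p` by `1 - p`. -/
lemma bern_map_not (p : unitInterval) :
    (bern ι p).map (fun ω k => !ω k) = bern ι (unitInterval.symm p) := by
  have h := Measure.infinitePi_map_pi (μ := fun _ : ι => bernoulliMeasure true false p)
    (f := fun _ : ι => Bool.not) (fun _ => measurable_of_countable _)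
  unfold bern
  rw [h]
  congr 1
  funext i
  ext s hs
  rw [Measure.map_apply (measurable_of_countable _) hs]
  rw [bernoulliMeasure_def, bernoulliMeasure_def, Measure.add_apply, Measure.add_apply,
    Measure.smul_apply, Measure.smul_apply, Measure.smul_apply, Measure.smul_apply,
    unitInterval.symm_symm]
  rw [Measure.dirac_apply' _ hs, Measure.dirac_apply' _ hs,
    Measure.dirac_apply' _ MeasurableSet.of_discrete,
    Measure.dirac_apply' _ MeasurableSet.of_discrete, add_comm]
  rfl

lemma bern_reindex {A : Set (κ → Bool)} {I : Finset κ} (hA : DependsOn (· ∈ A) (I : Set κ))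
    (p : unitInterval) (e : κ ≃ ι) :
    (bern ι p).real {ω | (fun k => ω (e k)) ∈ A} = (bern κ p).real A := by
  rw [← bern_map_reindex p e, map_measureReal_apply (by fun_prop) (measurableSet_of_dependsOn hA)]
  rfl

lemma bern_not_reindex {A : Set (κ → Bool)} {I : Finset κ} (hA : DependsOn (· ∈ A) (I : Set κ))
    (p : unitInterval) (e : κ ≃ ι) :
    (bern ι p).real {ω | (fun k => !ω (e k)) ∈ A} = (bern κ (unitInterval.symm p)).real A := by
  have hm : Measurable fun (ω : κ → Bool) k => !ω k :=
    measurable_pi_lambda _ fun k => (measurable_of_countable Bool.not).comp (measurable_pi_apply k)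
  rw [← bern_map_not p, ← bern_map_reindex p e, Measure.map_map hm (by fun_prop),
    map_measureReal_apply (hm.comp (by fun_prop)) (measurableSet_of_dependsOn hA)]
  rfl

end Bernoulli

/-! ### Percolation on a locally finite graph -/

/-- A locally finite graph presented by its edges: `E` is the type of edges, and `src e`, `tgt e`
are the two ends of `e`, in an order that plays no role for connections. -/
structure EdgeGraph (V E : Type*) where
  src : E → V
  tgt : E → V
  finite_inc : ∀ v, {e | src e = v ∨ tgt e = v}.Finite

namespace EdgeGraph

variable {V E : Type*} (G : EdgeGraph V E)

/-- The edge `e` has ends `x` and `y`. -/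
def Joins (e : E) (x y : V) : Prop := (G.src e = x ∧ G.tgt e = y) ∨ (G.src e = y ∧ G.tgt e = x)

/-- `x` and `y` are joined by a path of edges of `K`. -/
def Conn (K : Set E) : V → V → Prop := Relation.ReflTransGen fun x y => ∃ e ∈ K, G.Joins e x y

/-- The edges with at least one end in `U`. -/
def touch (U : Set V) : Set E := {e | G.src e ∈ U ∨ G.tgt e ∈ U}

/-- The edges with both ends in `U`. -/
def inside (U : Set V) : Set E := {e | G.src e ∈ U ∧ G.tgt e ∈ U}

/-- The open edges of a configuration. -/
def opn (ω : E → Bool) : Set E := {e | ω e = true}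

/-- The event that an open path that avoids the edges in `L` leads from `x` out of `U`. -/
def ExitOff (L : Set E) (U : Set V) (x : V) : Set (E → Bool) :=
  {ω | ∃ z, z ∉ U ∧ G.Conn (opn ω \ L) x z}

/-- The event that an open path leads from `x` out of `U`. -/
def Exit (U : Set V) (x : V) : Set (E → Bool) := {ω | ∃ z, z ∉ U ∧ G.Conn (opn ω) x z}

variable {G}

lemma Joins.symm {e : E} {x y : V} (h : G.Joins e x y) : G.Joins e y x := Or.symm h

lemma joins_src_tgt (e : E) : G.Joins e (G.src e) (G.tgt e) := Or.inl ⟨rfl, rfl⟩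

lemma Joins.mem_touch_left {e : E} {x y : V} (h : G.Joins e x y) {U : Set V} (hx : x ∈ U) :
    e ∈ G.touch U := by
  rcases h with ⟨rfl, rfl⟩ | ⟨rfl, rfl⟩
  · exact Or.inl hx
  · exact Or.inr hx

lemma Joins.mem_touch {e : E} {x y : V} (h : G.Joins e x y) {U : Set V} :
    e ∈ G.touch U ↔ x ∈ U ∨ y ∈ U := by
  rcases h with ⟨rfl, rfl⟩ | ⟨rfl, rfl⟩
  · exact Iff.rfl
  · exact or_comm

lemma Joins.mem_inside {e : E} {x y : V} (h : G.Joins e x y) {U : Set V} :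
    e ∈ G.inside U ↔ x ∈ U ∧ y ∈ U := by
  rcases h with ⟨rfl, rfl⟩ | ⟨rfl, rfl⟩
  · exact Iff.rfl
  · exact and_comm

lemma inside_subset_touch (U : Set V) : G.inside U ⊆ G.touch U := fun _ h => Or.inl h.1

lemma touch_mono {U W : Set V} (h : U ⊆ W) : G.touch U ⊆ G.touch W :=
  fun _ he => he.imp (@h _) (@h _)

lemma Conn.mono {K K' : Set E} (hK : K ⊆ K') {x y : V} (h : G.Conn K x y) : G.Conn K' x y :=
  Relation.ReflTransGen.mono (fun _ _ ⟨e, he, hj⟩ => ⟨e, hK he, hj⟩) _ _ h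

lemma Conn.refl {K : Set E} (x : V) : G.Conn K x x := Relation.ReflTransGen.refl

lemma Conn.trans {K : Set E} {x y z : V} (h : G.Conn K x y) (h' : G.Conn K y z) : G.Conn K x z :=
  Relation.ReflTransGen.trans h h'

lemma Conn.symm {K : Set E} {x y : V} (h : G.Conn K x y) : G.Conn K y x := by
  induction h with
  | refl => exact Relation.ReflTransGen.refl
  | tail _ h ih =>
    obtain ⟨e, he, hj⟩ := h
    exact Relation.ReflTransGen.head ⟨e, he, hj.symm⟩ ih

lemma Joins.conn {K : Set E} {e : E} {x y : V} (h : G.Joins e x y) (he : e ∈ K) : G.Conn K x y :=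
  Relation.ReflTransGen.single ⟨e, he, h⟩

/-- Induction along a path, from its last vertex to its first. -/
lemma Conn.head_induction {K : Set E} {z : V} {P : V → Prop} (hz : P z)
    (step : ∀ x y e, e ∈ K → G.Joins e x y → G.Conn K y z → P y → P x) {x : V}
    (h : G.Conn K x z) : P x := by
  induction h using Relation.ReflTransGen.head_induction_on with
  | refl => exact hz
  | head h' h ih =>
    obtain ⟨e, he, hj⟩ := h'
    exact step _ _ e he hj h ih

lemma opn_mono {ω ω' : E → Bool} (h : ω ≤ ω') : opn ω ⊆ opn ω' := by
  intro e he
  have := h e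
  simp only [opn, Set.mem_ofPred_eq] at he ⊢
  rw [he] at this
  exact top_le_iff.1 this

/-- A path that leaves `U` may be stopped as soon as it is out of `U`. -/
lemma Conn.exit {K : Set E} {U : Set V} {x z : V} (h : G.Conn K x z) (hz : z ∉ U) :
    ∃ z', z' ∉ U ∧ G.Conn (K ∩ G.touch U) x z' := by
  refine Conn.head_induction (P := fun x => ∃ z', z' ∉ U ∧ G.Conn (K ∩ G.touch U) x z')
    ⟨z, hz, Conn.refl _⟩ ?_ h
  rintro x y e he hj - ⟨z', hz', hc⟩
  by_cases hx : x ∈ U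
  · exact ⟨z', hz', (hj.conn (K := K ∩ G.touch U) ⟨he, hj.mem_touch_left hx⟩).trans hc⟩
  · exact ⟨x, hx, Conn.refl _⟩

lemma dependsOn_exitOff (L : Set E) (U : Set V) (x : V) :
    DependsOn (· ∈ G.ExitOff L U x) (G.touch U \ L) := by
  refine dependsOn_of_imp ?_
  rintro ω ω' h ⟨z, hz, hc⟩
  obtain ⟨z', hz', hc'⟩ := hc.exit hz
  refine ⟨z', hz', hc'.mono ?_⟩
  rintro e ⟨⟨he, heL⟩, heU⟩
  refine ⟨?_, heL⟩
  have := h e ⟨heU, heL⟩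
  simp only [opn, Set.mem_ofPred_eq] at he ⊢
  rwa [← this]

lemma exitOff_empty (U : Set V) (x : V) : G.ExitOff ∅ U x = G.Exit U x := by
  simp [ExitOff, Exit]

lemma dependsOn_exit (U : Set V) (x : V) : DependsOn (· ∈ G.Exit U x) (G.touch U) := by
  have := dependsOn_exitOff (G := G) ∅ U x
  rwa [exitOff_empty, Set.sdiff_empty] at this

lemma isUpperSet_exitOff (L : Set E) (U : Set V) (x : V) : IsUpperSet (G.ExitOff L U x) := by
  rintro ω ω' h ⟨z, hz, hc⟩
  exact ⟨z, hz, hc.mono (Set.sdiff_subset_sdiff_left (opn_mono h))⟩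

lemma isUpperSet_exit (U : Set V) (x : V) : IsUpperSet (G.Exit U x) := by
  rw [← exitOff_empty]; exact isUpperSet_exitOff _ _ _

lemma exit_anti {U W : Set V} (h : U ⊆ W) (x : V) : G.Exit W x ⊆ G.Exit U x := by
  rintro ω ⟨z, hz, hc⟩
  exact ⟨z, fun hzU => hz (h hzU), hc⟩

variable (G) in
lemma finite_touch (U : Finset V) : (G.touch (U : Set V)).Finite := by
  have : G.touch (U : Set V) = ⋃ v ∈ U, {e | G.src e = v ∨ G.tgt e = v} := by
    ext e
    simp only [touch, Set.mem_ofPred_eq, Finset.mem_coe, Set.mem_iUnion, exists_prop]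
    constructor
    · rintro (h | h)
      · exact ⟨_, h, Or.inl rfl⟩
      · exact ⟨_, h, Or.inr rfl⟩
    · rintro ⟨v, hv, rfl | rfl⟩
      · exact Or.inl hv
      · exact Or.inr hv
  rw [this]
  exact U.finite_toSet.biUnion fun v _ => G.finite_inc v

variable (G) in
/-- The finite set of the edges with at least one end in the finite set `U`. -/
noncomputable def touchF (U : Finset V) : Finset E := (G.finite_touch U).toFinset

@[simp] lemma coe_touchF (U : Finset V) : (G.touchF U : Set E) = G.touch U := by
  simp [touchF]

@[simp] lemma mem_touchF {U : Finset V} {e : E} : e ∈ G.touchF U ↔ e ∈ G.touch (U : Set V) := by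
  simp [touchF]

lemma dependsOn_exit_touchF (U : Finset V) (x : V) :
    DependsOn (· ∈ G.Exit (U : Set V) x) (G.touchF U : Set E) := by
  rw [coe_touchF]; exact dependsOn_exit _ _

/-! ### The boundary functional of Duminil-Copin and Tassion -/

variable (G) in
/-- The event that `o` is joined inside `S` to the end in `S` of the boundary edge `e`. It is empty
if `e` is not a boundary edge of `S`. -/
def ToBdry (S : Set V) (o : V) (e : E) : Set (E → Bool) :=
  {ω | ∃ x y, x ∈ S ∧ y ∉ S ∧ G.Joins e x y ∧ G.Conn (opn ω ∩ G.inside S) o x}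

variable (G) in
/-- The expected number of open boundary edges of `S` whose end in `S` is joined to `o` inside
`S`. -/
noncomputable def phi (p : unitInterval) (S : Finset V) (o : V) : ℝ :=
  p * ∑ e ∈ G.touchF S, (bern E p).real (G.ToBdry S o e)

lemma dependsOn_toBdry (S : Set V) (o : V) (e : E) :
    DependsOn (· ∈ G.ToBdry S o e) (G.inside S) := by
  refine dependsOn_of_imp ?_
  rintro ω ω' h ⟨x, y, hx, hy, hj, hc⟩
  refine ⟨x, y, hx, hy, hj, hc.mono ?_⟩
  rintro f ⟨hf, hfS⟩
  refine ⟨?_, hfS⟩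
  have := h f hfS
  simp only [opn, Set.mem_ofPred_eq] at hf ⊢
  rwa [← this]

lemma dependsOn_mono {ι : Type*} {A : Set (ι → Bool)} {I J : Set ι}
    (hA : DependsOn (· ∈ A) I) (h : I ⊆ J) : DependsOn (· ∈ A) J :=
  DependsOn.mono h hA

lemma isUpperSet_toBdry (S : Set V) (o : V) (e : E) : IsUpperSet (G.ToBdry S o e) := by
  rintro ω ω' h ⟨x, y, hx, hy, hj, hc⟩
  exact ⟨x, y, hx, hy, hj, hc.mono (Set.inter_subset_inter_left _ (opn_mono h))⟩

lemma dependsOn_toBdry_touchF (S : Finset V) (o : V) (e : E) :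
    DependsOn (· ∈ G.ToBdry (S : Set V) o e) (G.touchF S : Set E) := by
  rw [coe_touchF]
  exact dependsOn_mono (dependsOn_toBdry _ _ _) (inside_subset_touch _)

lemma phi_mono {p q : unitInterval} (h : p ≤ q) (S : Finset V) (o : V) :
    G.phi p S o ≤ G.phi q S o := by
  refine mul_le_mul h (Finset.sum_le_sum fun e _ => ?_)
    (Finset.sum_nonneg fun _ _ => measureReal_nonneg) q.2.1
  exact bern_mono (dependsOn_toBdry_touchF S o e) (isUpperSet_toBdry _ _ _) h

lemma bern_real_open {ι : Type*} (p : unitInterval) (e : ι) :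
    (bern ι p).real {ω | ω e = true} = p := by
  classical
  have : {ω : ι → Bool | ω e = true} = cyl {e} {e} := by
    ext ω; simp [cyl]
  rw [this, bern_real_cyl p _ _ subset_rfl]
  simp

open Classical in
variable (G) in
/-- The cluster of `o` inside the finite set `S`. -/
noncomputable def cluster (S : Finset V) (o : V) (ω : E → Bool) : Finset V :=
  S.filter fun x => G.Conn (opn ω ∩ G.inside S) o x

lemma dependsOn_cluster (S : Finset V) (o : V) (C : Finset V) (ho : o ∈ S) :
    DependsOn (· ∈ {ω | G.cluster S o ω = C}) (G.inside (S : Set V) ∩ G.touch (C : Set V)) := by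
  classical
  refine dependsOn_of_imp ?_
  rintro ω ω' h rfl
  have hmem : ∀ x, x ∈ G.cluster S o ω ↔ x ∈ S ∧ G.Conn (opn ω ∩ G.inside S) o x := fun x => by
    simp [cluster]
  have hC : ∀ x, G.Conn (opn ω' ∩ G.inside S) o x → x ∈ G.cluster S o ω := by
    intro x hx
    induction hx with
    | refl => exact (hmem o).2 ⟨ho, Conn.refl _⟩
    | tail _ h1 ih =>
      obtain ⟨e, ⟨he, heS⟩, hj⟩ := h1
      have hx := (hmem _).1 ih
      have hy := (hj.mem_inside.1 heS).2
      refine (hmem _).2 ⟨hy, hx.2.trans (hj.conn ⟨?_, heS⟩)⟩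
      have := h e ⟨heS, hj.mem_touch_left ih⟩
      simp only [opn, Set.mem_ofPred_eq] at he ⊢
      rwa [this]
  have hC' : ∀ x, G.Conn (opn ω ∩ G.inside S) o x → G.Conn (opn ω' ∩ G.inside S) o x := by
    intro x hx
    induction hx with
    | refl => exact Conn.refl _
    | tail h0 h1 ih =>
      obtain ⟨e, ⟨he, heS⟩, hj⟩ := h1
      refine ih.trans (hj.conn ⟨?_, heS⟩)
      have := h e ⟨heS, hj.mem_touch_left (by
        exact (hmem _).2 ⟨(hj.mem_inside.1 heS).1, h0⟩)⟩
      simp only [opn, Set.mem_ofPred_eq] at he ⊢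
      rwa [← this]
  simp only [Set.mem_ofPred_eq]
  ext x
  rw [hmem]
  simp only [cluster, Finset.mem_filter]
  exact ⟨fun hx => ⟨hx.1, ((hmem x).1 (hC x hx.2)).2⟩, fun hx => ⟨hx.1, hC' x hx.2⟩⟩

/-- The last edge of a path that leaves the set `C`. -/
lemma Conn.last_exit {K : Set E} {C : Set V} {x z : V} (h : G.Conn K x z) (hz : z ∉ C)
    (hx : x ∈ C) : ∃ u v e, u ∈ C ∧ v ∉ C ∧ e ∈ K ∧ G.Joins e u v ∧
      G.Conn (K \ G.touch C) v z := by
  have key : (x ∉ C ∧ G.Conn (K \ G.touch C) x z) ∨ ∃ u v e, u ∈ C ∧ v ∉ C ∧ e ∈ K ∧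
      G.Joins e u v ∧ G.Conn (K \ G.touch C) v z := by
    refine Conn.head_induction (P := fun x => (x ∉ C ∧ G.Conn (K \ G.touch C) x z) ∨
      ∃ u v e, u ∈ C ∧ v ∉ C ∧ e ∈ K ∧ G.Joins e u v ∧ G.Conn (K \ G.touch C) v z)
      (Or.inl ⟨hz, Conn.refl _⟩) ?_ h
    rintro x y e he hj - (⟨hy, hc⟩ | h)
    · by_cases hx : x ∈ C
      · exact Or.inr ⟨x, y, e, hx, hy, he, hj, hc⟩
      · refine Or.inl ⟨hx, (hj.conn (K := K \ G.touch C) ⟨he, ?_⟩).trans hc⟩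
        rw [hj.mem_touch]; tauto
    · exact Or.inr h
  rcases key with h | h
  · exact absurd hx h.1
  · exact h

/-- An exit from `W` passes through a boundary edge of `S ⊆ W`, and the part of the path after it
may be taken off the cluster of `o` in `S`: this is what makes the three factors independent. -/
lemma exit_le_phi_mul (p : unitInterval) {S W : Finset V} {o : V} (ho : o ∈ S) (hSW : S ⊆ W)
    {m : ℝ} (hm0 : 0 ≤ m)
    (hm : ∀ x y e, x ∈ S → y ∉ S → G.Joins e x y → (bern E p).real (G.Exit W y) ≤ m) :
    (bern E p).real (G.Exit W o) ≤ G.phi p S o * m := by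
  classical
  set F : Finset V → E → Set (E → Bool) := fun C e =>
    {ω | ∃ x y, x ∈ C ∧ y ∉ S ∧ G.Joins e x y ∧ ω ∈ G.ExitOff (G.touch C) W y} with hF
  set T : Finset V → E → Set (E → Bool) := fun C e =>
    ({ω | G.cluster S o ω = C} ∩ {ω | ω e = true}) ∩ F C e with hT
  -- `C` is the cluster of `o` in `S`, and `e` is the last edge of an exit path that has an end in `C`
  have hcover : G.Exit W o ⊆ ⋃ e ∈ G.touchF S, ⋃ C ∈ S.powerset, T C e := by
    rintro ω ⟨z, hz, hc⟩
    have hzC : z ∉ (G.cluster S o ω : Set V) := by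
      intro h
      have h' : z ∈ S := (Finset.mem_filter.1 (Finset.mem_coe.1 h)).1
      exact hz (hSW h')
    have hoC : o ∈ (G.cluster S o ω : Set V) := by
      simp [cluster, ho, Conn.refl]
    obtain ⟨u, v, e, hu, hv, he, hj, hcv⟩ := hc.last_exit hzC hoC
    have hu' := Finset.mem_filter.1 (Finset.mem_coe.1 hu)
    have hvS : v ∉ S := by
      intro hvS
      apply hv
      refine Finset.mem_coe.2 (Finset.mem_filter.2 ⟨hvS, hu'.2.trans (hj.conn ⟨he, ?_⟩)⟩)
      exact hj.mem_inside.2 ⟨hu'.1, hvS⟩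
    simp only [Set.mem_iUnion]
    refine ⟨e, mem_touchF.2 (hj.mem_touch_left (Finset.mem_coe.2 hu'.1)), G.cluster S o ω,
      Finset.mem_powerset.2 (Finset.filter_subset _ _), ⟨rfl, he⟩, u, v, hu, hvS, hj, z, hz, hcv⟩
  have hbound : ∀ e ∈ G.touchF S, ∀ C ∈ S.powerset, (bern E p).real (T C e) ≤
      p * m * (bern E p).real ({ω | G.cluster S o ω = C} ∩ G.ToBdry S o e) := by
    intro e _ C hC
    rw [Finset.mem_powerset] at hC
    by_cases hex : ∃ x y, x ∈ C ∧ y ∉ S ∧ G.Joins e x y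
    · obtain ⟨x, y, hx, hy, hj⟩ := hex
      -- the end of `e` out of `S` is determined by `e`
      have hy1 : ∀ x' y', x' ∈ C → y' ∉ S → G.Joins e x' y' → y' = y := by
        rintro x' y' hx' hy' hj'
        rcases hj with ⟨rfl, rfl⟩ | ⟨rfl, rfl⟩ <;> rcases hj' with ⟨h1, h2⟩ | ⟨h1, h2⟩
        · exact h2.symm
        · exact absurd (hC hx) (h1 ▸ hy')
        · exact absurd (hC hx) (h2 ▸ hy')
        · exact h1.symm
      have hFe : F C e ⊆ G.ExitOff (G.touch C) W y := by
        rintro ω ⟨x', y', hx', hy', hj', h⟩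
        rwa [hy1 x' y' hx' hy' hj'] at h
      have hdep1 := dependsOn_cluster (G := G) S o C ho
      have hfin : (G.inside (S : Set V) ∩ G.touch (C : Set V)).Finite :=
        ((G.finite_touch S).subset (inside_subset_touch _)).inter_of_left _
      have hd1 : DependsOn (· ∈ {ω | G.cluster S o ω = C}) (hfin.toFinset : Set E) := by
        rw [Set.Finite.coe_toFinset]; exact hdep1
      have hd2 : DependsOn (· ∈ {ω : E → Bool | ω e = true}) (({e} : Finset E) : Set E) := by
        refine dependsOn_of_imp fun ω ω' h hω => ?_
        have := h e (by simp)
        simp only [Set.mem_ofPred_eq] at hω ⊢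
        rwa [← this]
      -- the three factors depend on disjoint sets of edges: those inside `S` that touch `C`, the
      -- edge `e`, and those that do not touch `C`
      have heS : e ∉ G.inside (S : Set V) := fun h => hy (hj.mem_inside.1 h).2
      have hdis1 : Disjoint hfin.toFinset {e} := by
        rw [Finset.disjoint_singleton_right, Set.Finite.mem_toFinset]
        exact fun h => heS h.1
      have hfin3 : (G.touch (W : Set V) \ G.touch (C : Set V)).Finite :=
        (G.finite_touch W).sdiff
      have hd3 : DependsOn (· ∈ G.ExitOff (G.touch C) W y) (hfin3.toFinset : Set E) := by
        rw [Set.Finite.coe_toFinset]; exact dependsOn_exitOff _ _ _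
      have hd12 : DependsOn (· ∈ {ω | G.cluster S o ω = C} ∩ {ω | ω e = true})
          ((hfin.toFinset ∪ {e} : Finset E) : Set E) :=
        dependsOn_inter (dependsOn_mono hd1 (by simp)) (dependsOn_mono hd2 (by simp))
      have hdis2 : Disjoint (hfin.toFinset ∪ {e}) hfin3.toFinset := by
        rw [Finset.disjoint_left]
        intro f hf hf3
        rw [Set.Finite.mem_toFinset] at hf3
        rw [Finset.mem_union, Set.Finite.mem_toFinset, Finset.mem_singleton] at hf
        rcases hf with hf | rfl
        · exact hf3.2 hf.2
        · exact hf3.2 (hj.mem_touch_left (Finset.mem_coe.2 hx))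
      have h1 : (bern E p).real (T C e) ≤ (bern E p).real
          (({ω | G.cluster S o ω = C} ∩ {ω | ω e = true}) ∩ G.ExitOff (G.touch C) W y) :=
        measureReal_mono (Set.inter_subset_inter_right _ hFe)
      rw [bern_indep hdis2 hd12 hd3, bern_indep hdis1 hd1 hd2, bern_real_open] at h1
      have h2 : (bern E p).real (G.ExitOff (G.touch C) W y) ≤ m := by
        refine le_trans (measureReal_mono ?_) (hm x y e (hC hx) hy hj)
        rintro ω ⟨z, hz, hc⟩
        exact ⟨z, hz, hc.mono Set.sdiff_subset⟩
      have h3 : {ω | G.cluster S o ω = C} ∩ G.ToBdry S o e = {ω | G.cluster S o ω = C} := by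
        refine Set.inter_eq_left.2 ?_
        rintro ω rfl
        exact ⟨x, y, hC hx, hy, hj, (Finset.mem_filter.1 hx).2⟩
      rw [h3]
      refine h1.trans ?_
      have h4 : 0 ≤ (bern E p).real {ω | G.cluster S o ω = C} * (p : ℝ) :=
        mul_nonneg measureReal_nonneg p.2.1
      nlinarith [mul_le_mul_of_nonneg_left h2 h4]
    · have : T C e = ∅ := by
        rw [Set.eq_empty_iff_forall_notMem]
        rintro ω ⟨-, x, y, hx, hy, hj, -⟩
        exact hex ⟨x, y, hx, hy, hj⟩
      rw [this, measureReal_empty]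
      exact mul_nonneg (mul_nonneg p.2.1 hm0) measureReal_nonneg
  have hsum : ∀ e ∈ G.touchF S, ∑ C ∈ S.powerset,
      (bern E p).real ({ω | G.cluster S o ω = C} ∩ G.ToBdry S o e) ≤
        (bern E p).real (G.ToBdry S o e) := by
    intro e _
    rw [← measureReal_biUnion_finset]
    · exact measureReal_mono (Set.iUnion₂_subset fun C _ => Set.inter_subset_right)
    · intro C _ C' _ hne
      refine Set.disjoint_left.2 ?_
      rintro ω ⟨h1, -⟩ ⟨h2, -⟩
      exact hne (h1.symm.trans h2)
    · intro C _
      refine MeasurableSet.inter ?_ (measurableSet_of_dependsOn (dependsOn_toBdry_touchF S o e))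
      refine measurableSet_of_dependsOn (I := G.touchF S) ?_
      rw [coe_touchF]
      exact dependsOn_mono (dependsOn_cluster S o C ho)
        (Set.inter_subset_left.trans (inside_subset_touch _))
  calc (bern E p).real (G.Exit W o)
      ≤ (bern E p).real (⋃ e ∈ G.touchF S, ⋃ C ∈ S.powerset, T C e) :=
        measureReal_mono hcover (measure_ne_top _ _)
    _ ≤ ∑ e ∈ G.touchF S, (bern E p).real (⋃ C ∈ S.powerset, T C e) :=
        measureReal_biUnion_finset_le _ _
    _ ≤ ∑ e ∈ G.touchF S, ∑ C ∈ S.powerset, (bern E p).real (T C e) :=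
        Finset.sum_le_sum fun e _ => measureReal_biUnion_finset_le _ _
    _ ≤ ∑ e ∈ G.touchF S, ∑ C ∈ S.powerset,
          p * m * (bern E p).real ({ω | G.cluster S o ω = C} ∩ G.ToBdry S o e) :=
        Finset.sum_le_sum fun e he => Finset.sum_le_sum fun C hC => hbound e he C hC
    _ ≤ ∑ e ∈ G.touchF S, p * m * (bern E p).real (G.ToBdry S o e) := by
        refine Finset.sum_le_sum fun e he => ?_
        rw [← Finset.mul_sum]
        exact mul_le_mul_of_nonneg_left (hsum e he) (mul_nonneg p.2.1 hm0)
    _ = G.phi p S o * m := by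
        rw [← Finset.mul_sum, phi]; ring

/-! ### The differential inequality -/

open Classical in
variable (G) in
/-- The vertices of `U` from which no open path leads out of `U`. -/
noncomputable def trapped (U : Finset V) (ω : E → Bool) : Finset V :=
  U.filter fun x => ω ∉ G.Exit U x

lemma mem_trapped {U : Finset V} {ω : E → Bool} {x : V} :
    x ∈ G.trapped U ω ↔ x ∈ U ∧ ω ∉ G.Exit U x := by
  classical
  simp [trapped]

lemma exit_of_not_mem_trapped {U : Finset V} {ω : E → Bool} {x : V} (h : x ∉ G.trapped U ω) :
    ω ∈ G.Exit U x := by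
  by_cases hx : x ∈ U
  · by_contra h'
    exact h (mem_trapped.2 ⟨hx, h'⟩)
  · exact ⟨x, hx, Conn.refl _⟩

lemma Joins.exit {U : Set V} {ω : E → Bool} {x y : V} {e : E} (hj : G.Joins e x y)
    (he : ω e = true) (h : ω ∈ G.Exit U y) : ω ∈ G.Exit U x := by
  obtain ⟨z, hz, hc⟩ := h
  exact ⟨z, hz, (hj.conn he).trans hc⟩

/-- The set of trapped vertices is found by exploring only edges outside of it. -/
lemma dependsOn_trapped (U S : Finset V) :
    DependsOn (· ∈ {ω | G.trapped U ω = S}) (G.touch (U : Set V) \ G.inside (S : Set V)) := by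
  classical
  refine dependsOn_of_imp ?_
  rintro ω ω' h rfl
  have h1 : ∀ x, x ∈ G.trapped U ω → ω' ∉ G.Exit U x := by
    rintro x hx ⟨z, hz, hc⟩
    refine Conn.head_induction (P := fun x => x ∉ G.trapped U ω) ?_ ?_ hc hx
    · exact fun h => hz (mem_trapped.1 h).1
    · rintro x y e he hj - hy hx
      have hx' := mem_trapped.1 hx
      refine hx'.2 (hj.exit (e := e) ?_ (exit_of_not_mem_trapped hy))
      rw [h e ⟨hj.mem_touch_left (Finset.mem_coe.2 hx'.1), fun h =>
        hy (Finset.mem_coe.1 (hj.mem_inside.1 h).2)⟩]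
      exact he
  have h2 : ∀ x, ω ∈ G.Exit U x → ω' ∈ G.Exit U x := by
    rintro x ⟨z, hz, hc⟩
    refine Conn.head_induction (P := fun x => ω' ∈ G.Exit U x) ⟨z, hz, Conn.refl _⟩ ?_ hc
    rintro x y e he hj hc hy
    by_cases hx : x ∈ (U : Set V)
    · refine hj.exit (e := e) ?_ hy
      rw [← h e ⟨hj.mem_touch_left hx, fun hin => ?_⟩]
      · exact he
      · exact (mem_trapped.1 (Finset.mem_coe.1 (hj.mem_inside.1 hin).1)).2
          ⟨z, hz, (hj.conn he).trans hc⟩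
    · exact ⟨x, hx, Conn.refl _⟩
  simp only [Set.mem_ofPred_eq]
  ext x
  constructor
  · intro hx
    have hx' := mem_trapped.1 hx
    exact mem_trapped.2 ⟨hx'.1, fun h => hx'.2 (h2 x h)⟩
  · intro hx
    exact mem_trapped.2 ⟨(mem_trapped.1 hx).1, h1 x hx⟩

/-- A boundary edge of the set of trapped vertices that is joined to `o` is pivotal for the exit of
`o`. -/
lemma influence_exit_eq_one [DecidableEq E] {U : Finset V} {o : V} {e : E} {ω : E → Bool}
    (ho : o ∈ G.trapped U ω) (h : ω ∈ G.ToBdry (G.trapped U ω) o e) :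
    influence e (one (G.Exit U o)) ω = 1 := by
  obtain ⟨x, y, hx, hy, hj, hc⟩ := h
  have hle1 : ω ≤ Function.update ω e true := by
    intro f
    by_cases hf : f = e
    · subst hf; simp [Bool.le_true]
    · simp [hf]
  have hle2 : Function.update ω e false ≤ ω := by
    intro f
    by_cases hf : f = e
    · subst hf; simp
    · simp [hf]
  have hin : Function.update ω e true ∈ G.Exit U o := by
    obtain ⟨z, hz, hc'⟩ := hj.exit (U := (U : Set V)) (e := e) (ω := Function.update ω e true)
      (by simp) (isUpperSet_exit _ _ hle1 (exit_of_not_mem_trapped hy))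
    exact ⟨z, hz, (hc.mono (Set.inter_subset_left.trans (opn_mono hle1))).trans hc'⟩
  have hout : Function.update ω e false ∉ G.Exit U o := fun h =>
    (mem_trapped.1 ho).2 (isUpperSet_exit _ _ hle2 h)
  simp [influence, one, hin, hout]

lemma influence_one_nonneg {ι : Type*} [DecidableEq ι] {A : Set (ι → Bool)} (hA : IsUpperSet A)
    (e : ι) (ω : ι → Bool) : 0 ≤ influence e (one A) ω :=
  sub_nonneg.2 (monotone_one hA (update_le_update_iff.2 ⟨by simp, fun _ _ => le_rfl⟩))

/-- If `φ_p(S) ≥ 1` for all finite `S`, then the derivative of the probability of an exit is at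
least the probability of no exit. -/
lemma one_sub_exit_le_deriv [DecidableEq E] (p : unitInterval) {U : Finset V} {o : V} (ho : o ∈ U)
    (hphi : ∀ S : Finset V, o ∈ S → 1 ≤ G.phi p S o) :
    1 - Ex (G.touchF U) p (one (G.Exit U o)) ≤
      ∑ e ∈ G.touchF U, Ex (G.touchF U) p (influence e (one (G.Exit U o))) := by
  classical
  have hdep := dependsOn_exit_touchF (G := G) U o
  set P := U.powerset.filter fun S => o ∈ S with hP
  have hmT : ∀ S : Finset V, DependsOn (· ∈ {ω | G.trapped U ω = S}) (G.touchF U : Set E) := by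
    intro S
    rw [coe_touchF]
    exact dependsOn_mono (dependsOn_trapped U S) Set.sdiff_subset
  have hmB : ∀ S ∈ P, ∀ e, DependsOn (· ∈ G.ToBdry (S : Set V) o e) (G.touchF U : Set E) := by
    intro S hS e
    rw [coe_touchF]
    exact dependsOn_mono (dependsOn_toBdry _ _ _) ((inside_subset_touch _).trans
      (touch_mono (Finset.coe_subset.2 (Finset.mem_powerset.1 (Finset.mem_filter.1 hS).1))))
  -- the events in the sum are disjoint, and on each of them `e` is pivotal
  have hinf : ∀ e, ∑ S ∈ P, (bern E p).real ({ω | G.trapped U ω = S} ∩ G.ToBdry S o e) ≤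
      Ex (G.touchF U) p (influence e (one (G.Exit U o))) := by
    intro e
    rw [← integral_eq_Ex (dependsOn_influence (dependsOn_one hdep) e) p,
      ← measureReal_biUnion_finset]
    · have hdU : DependsOn (· ∈ ⋃ S ∈ P, {ω | G.trapped U ω = S} ∩ G.ToBdry (S : Set V) o e)
          (G.touchF U : Set E) := by
        refine dependsOn_of_imp fun ω ω' h hω => ?_
        simp only [Set.mem_iUnion] at hω ⊢
        obtain ⟨S, hS, hω⟩ := hω
        exact ⟨S, hS, (mem_iff_of_dependsOn (dependsOn_inter (hmT S) (hmB S hS e)) h).1 hω⟩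
      rw [← integral_one hdU]
      refine integral_mono (integrable_of_dependsOn (dependsOn_one hdU) p)
        (integrable_of_dependsOn (dependsOn_influence (dependsOn_one hdep) e) p) fun ω => ?_
      by_cases hω : ω ∈ ⋃ S ∈ P, {ω | G.trapped U ω = S} ∩ G.ToBdry (S : Set V) o e
      · have hω' := hω
        simp only [Set.mem_iUnion] at hω'
        obtain ⟨S, hS, rfl, hb⟩ := hω'
        rw [influence_exit_eq_one (Finset.mem_filter.1 hS).2 hb, one, Set.indicator_of_mem hω]
        rfl
      · rw [one, Set.indicator_of_notMem hω]
        exact influence_one_nonneg (isUpperSet_exit _ _) e ω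
    · intro S _ S' _ hne
      refine Set.disjoint_left.2 ?_
      rintro ω ⟨h1, -⟩ ⟨h2, -⟩
      exact hne (h1.symm.trans h2)
    · intro S hS
      exact measurableSet_of_dependsOn (dependsOn_inter (hmT S) (hmB S hS e))
  have hind : ∀ S ∈ P, ∀ e, (bern E p).real ({ω | G.trapped U ω = S} ∩ G.ToBdry S o e) =
      (bern E p).real {ω | G.trapped U ω = S} * (bern E p).real (G.ToBdry S o e) := by
    intro S hS e
    have hf1 : (G.touch (U : Set V) \ G.inside (S : Set V)).Finite := (G.finite_touch U).sdiff
    have hf2 : (G.inside (S : Set V)).Finite := (G.finite_touch S).subset (inside_subset_touch _)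
    refine bern_indep (I := hf1.toFinset) (J := hf2.toFinset) ?_ ?_ ?_ p
    · rw [Finset.disjoint_left]
      intro f hf hf'
      rw [Set.Finite.mem_toFinset] at hf hf'
      exact hf.2 hf'
    · rw [Set.Finite.coe_toFinset]; exact dependsOn_trapped U S
    · rw [Set.Finite.coe_toFinset]; exact dependsOn_toBdry _ _ _
  have hsum : ∀ S ∈ P, 1 ≤ ∑ e ∈ G.touchF U, (bern E p).real (G.ToBdry S o e) := by
    intro S hS
    have hS' := Finset.mem_filter.1 hS
    have h1 := hphi S hS'.2
    have h2 : ∑ e ∈ G.touchF S, (bern E p).real (G.ToBdry S o e) ≤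
        ∑ e ∈ G.touchF U, (bern E p).real (G.ToBdry S o e) := by
      refine Finset.sum_le_sum_of_subset_of_nonneg ?_ fun _ _ _ => measureReal_nonneg
      intro e he
      exact mem_touchF.2 (touch_mono (Finset.coe_subset.2 (Finset.mem_powerset.1 hS'.1))
        (mem_touchF.1 he))
    have h3 : 0 ≤ ∑ e ∈ G.touchF S, (bern E p).real (G.ToBdry S o e) :=
      Finset.sum_nonneg fun _ _ => measureReal_nonneg
    refine h1.trans (le_trans ?_ h2)
    exact mul_le_of_le_one_left h3 p.2.2
  have hcompl : 1 - Ex (G.touchF U) p (one (G.Exit U o)) ≤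
      ∑ S ∈ P, (bern E p).real {ω | G.trapped U ω = S} := by
    rw [← real_eq_Ex hdep, ← bern_compl hdep]
    refine le_trans (measureReal_mono (s₂ := ⋃ S ∈ P, {ω | G.trapped U ω = S}) ?_
      (measure_ne_top _ _)) (measureReal_biUnion_finset_le _ _)
    intro ω hω
    simp only [Set.mem_iUnion]
    exact ⟨G.trapped U ω, Finset.mem_filter.2 ⟨Finset.mem_powerset.2 (Finset.filter_subset _ _),
      mem_trapped.2 ⟨ho, hω⟩⟩, rfl⟩
  calc 1 - Ex (G.touchF U) p (one (G.Exit U o))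
      ≤ ∑ S ∈ P, (bern E p).real {ω | G.trapped U ω = S} := hcompl
    _ ≤ ∑ S ∈ P, (bern E p).real {ω | G.trapped U ω = S} *
          ∑ e ∈ G.touchF U, (bern E p).real (G.ToBdry S o e) :=
        Finset.sum_le_sum fun S hS => le_mul_of_one_le_right measureReal_nonneg (hsum S hS)
    _ = ∑ e ∈ G.touchF U, ∑ S ∈ P,
          (bern E p).real ({ω | G.trapped U ω = S} ∩ G.ToBdry S o e) := by
        rw [Finset.sum_comm]
        refine Finset.sum_congr rfl fun S hS => ?_
        rw [Finset.mul_sum]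
        exact Finset.sum_congr rfl fun e _ => (hind S hS e).symm
    _ ≤ _ := Finset.sum_le_sum fun e _ => hinf e

/-- If `φ_{p₀}(S) ≥ 1` for all finite `S`, then at every `p₁ > p₀` the probability of an exit is
bounded below uniformly in the domain. -/
lemma exit_lower_bound {p₀ p₁ : unitInterval} (h01 : p₀ ≤ p₁) {U : Finset V} {o : V} (ho : o ∈ U)
    (hphi : ∀ S : Finset V, o ∈ S → 1 ≤ G.phi p₀ S o) :
    1 - Real.exp (-(p₁ - p₀ : ℝ)) ≤ (bern E p₁).real (G.Exit U o) := by
  classical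
  set f : ℝ → ℝ := fun p => Ex (G.touchF U) p (one (G.Exit U o)) with hf
  have hd : ∀ p, HasDerivAt f
      (∑ e ∈ G.touchF U, Ex (G.touchF U) p (influence e (one (G.Exit U o)))) p :=
    fun p => hasDerivAt_Ex _ _ p
  have hdep := dependsOn_exit_touchF (G := G) U o
  -- the differential inequality says that `(1 - f p) * exp p` is nonincreasing
  have hanti : AntitoneOn (fun p => (1 - f p) * Real.exp p) (Set.Icc (p₀ : ℝ) p₁) := by
    have hg : ∀ p, HasDerivAt (fun p => (1 - f p) * Real.exp p)
        (-(∑ e ∈ G.touchF U, Ex (G.touchF U) p (influence e (one (G.Exit U o)))) * Real.exp p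
          + (1 - f p) * Real.exp p) p := fun p => ((hd p).const_sub 1).mul (Real.hasDerivAt_exp p)
    refine antitoneOn_of_hasDerivWithinAt_nonpos (convex_Icc _ _)
      (fun x _ => (hg x).continuousAt.continuousWithinAt)
      (fun x _ => (hg x).hasDerivWithinAt) ?_
    intro x hx
    rw [interior_Icc] at hx
    have hx01 : x ∈ unitInterval := ⟨p₀.2.1.trans hx.1.le, hx.2.le.trans p₁.2.2⟩
    have := one_sub_exit_le_deriv (G := G) ⟨x, hx01⟩ ho fun S hS =>
      (hphi S hS).trans (phi_mono (Subtype.coe_le_coe.1 hx.1.le) S o)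
    have hexp := Real.exp_pos x
    simp only at this
    nlinarith
  have h := hanti (Set.left_mem_Icc.2 h01) (Set.right_mem_Icc.2 h01) h01
  rw [real_eq_Ex hdep]
  change 1 - _ ≤ f p₁
  have hf0 : 0 ≤ f p₀ := by
    change 0 ≤ Ex _ _ _
    rw [← real_eq_Ex hdep]; exact measureReal_nonneg
  have h2 : (1 - f p₁) * Real.exp p₁ ≤ Real.exp p₀ :=
    h.trans (mul_le_of_le_one_left (Real.exp_pos _).le (by linarith))
  have h3 : Real.exp (-(p₁ - p₀ : ℝ)) = Real.exp p₀ / Real.exp p₁ := by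
    rw [← Real.exp_sub]; ring_nf
  rw [h3, sub_le_comm, le_div_iff₀ (Real.exp_pos _)]
  exact h2

/-! ### Counting clusters -/

variable (G) in
/-- The event that the two ends of `e` lie, when `e` is removed, in different open clusters of the
edges that touch `U`, and that both clusters lead out of `U`. -/
def TwoArm (U : Set V) (e : E) : Set (E → Bool) :=
  {ω | ∃ x y, G.Joins e x y ∧ (∃ z, z ∉ U ∧ G.Conn ((opn ω ∩ G.touch U) \ {e}) x z) ∧
    (∃ z, z ∉ U ∧ G.Conn ((opn ω ∩ G.touch U) \ {e}) y z) ∧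
    ¬ G.Conn ((opn ω ∩ G.touch U) \ {e}) x y}

lemma dependsOn_twoArm (U : Set V) (e : E) : DependsOn (· ∈ G.TwoArm U e) (G.touch U) := by
  intro ω ω' h
  have : opn ω ∩ G.touch U = opn ω' ∩ G.touch U := by
    ext f
    simp only [opn, Set.mem_inter_iff, Set.mem_ofPred_eq]
    exact and_congr_left fun hf => by rw [h f hf]
  simp only [TwoArm, Set.mem_ofPred_eq, this]

lemma twoArm_mono {U W : Set V} (h : U ⊆ W) (e : E) :
    G.TwoArm W e ⊆ G.TwoArm U e := by
  have hsub : ∀ ω : E → Bool, (opn ω ∩ G.touch U) \ {e} ⊆ (opn ω ∩ G.touch W) \ {e} := fun ω =>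
    Set.sdiff_subset_sdiff_left (Set.inter_subset_inter_right _ (touch_mono h))
  have hex : ∀ (ω : E → Bool) x, (∃ z, z ∉ W ∧ G.Conn ((opn ω ∩ G.touch W) \ {e}) x z) →
      ∃ z, z ∉ U ∧ G.Conn ((opn ω ∩ G.touch U) \ {e}) x z := by
    rintro ω x ⟨z, hz, hc⟩
    obtain ⟨z', hz', hc'⟩ := hc.exit (U := U) fun hzU => hz (h hzU)
    refine ⟨z', hz', Conn.mono ?_ hc'⟩
    rintro f ⟨⟨⟨h1, -⟩, h2⟩, h3⟩
    exact ⟨⟨h1, h3⟩, h2⟩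
  rintro ω ⟨x, y, hj, hx, hy, hxy⟩
  exact ⟨x, y, hj, hex ω x hx, hex ω y hy, fun hc => hxy (hc.mono (hsub ω))⟩

open Classical in
variable (G) in
/-- The traces on `B` of the clusters of the edges in `K` that meet `B`. -/
noncomputable def traces (B : Finset V) (K : Set E) : Finset (Finset V) :=
  B.image fun z => B.filter fun w => G.Conn K z w

open Classical in
lemma traces_eq_image (B : Finset V) {K K' : Set E} (h : K ⊆ K') :
    G.traces B K' = (G.traces B K).image fun C => B.filter fun w => ∃ z ∈ C, G.Conn K' z w := by
  rw [traces, traces, Finset.image_image]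
  refine Finset.image_congr fun z hz => ?_
  simp only [Function.comp]
  ext w
  simp only [Finset.mem_filter]
  refine and_congr_right fun _ => ⟨fun hw => ⟨z, ⟨hz, Conn.refl z⟩, hw⟩, ?_⟩
  rintro ⟨z', ⟨-, h1⟩, h2⟩
  exact (h1.mono h).trans h2

lemma card_traces_le (B : Finset V) {K K' : Set E} (h : K ⊆ K') :
    (G.traces B K').card ≤ (G.traces B K).card := by
  classical
  rw [traces_eq_image B h]
  exact Finset.card_image_le

/-- Joining two clusters that meet `B` decreases the number of traces. -/
lemma card_traces_lt (B : Finset V) {K K' : Set E} (h : K ⊆ K') {z w : V} (hz : z ∈ B)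
    (hw : w ∈ B) (hK : ¬ G.Conn K z w) (hK' : G.Conn K' z w) :
    (G.traces B K').card < (G.traces B K).card := by
  classical
  refine lt_of_le_of_ne (card_traces_le B h) fun heq => ?_
  rw [traces_eq_image B h, Finset.card_image_iff] at heq
  have hmem : ∀ z ∈ B, (B.filter fun w => G.Conn K z w) ∈ G.traces B K := fun z hz =>
    Finset.mem_image_of_mem _ hz
  have key : ∀ z w, z ∈ B → w ∈ B → G.Conn K' z w → ∀ u,
      (∃ v ∈ B.filter (fun v => G.Conn K z v), G.Conn K' v u) →
      (∃ v ∈ B.filter (fun v => G.Conn K w v), G.Conn K' v u) := by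
    rintro z w _ hw hzw u ⟨v, hv, hvu⟩
    refine ⟨w, Finset.mem_filter.2 ⟨hw, Conn.refl _⟩, hzw.symm.trans ?_⟩
    exact ((Finset.mem_filter.1 hv).2.mono h).trans hvu
  have := heq (Finset.mem_coe.2 (hmem z hz)) (Finset.mem_coe.2 (hmem w hw)) (by
    refine Finset.filter_congr fun u _ => ?_
    exact ⟨key z w hz hw hK' u, key w z hw hz hK'.symm u⟩)
  have hw' : w ∈ B.filter fun u => G.Conn K z u := by
    rw [this]; exact Finset.mem_filter.2 ⟨hw, Conn.refl _⟩
  exact hK (Finset.mem_filter.1 hw').2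

/-- Each opening of an edge with two arms out of `U` lowers the number of clusters that meet the
boundary `B` of `U`. By Russo's formula, the sum of the two-arm probabilities, integrated over the
parameter, is therefore at most the size of `B`. -/
lemma twoArm_sum_le {U B : Finset V} (hB : ∀ e ∈ G.touch (U : Set V), ∀ x y, G.Joins e x y →
    x ∉ U → x ∈ B) {p₀ p₁ : unitInterval} (h01 : p₀ ≤ p₁) {m : ℝ}
    (hm : ∀ p : unitInterval, p₀ ≤ p → p ≤ p₁ →
      m ≤ ∑ e ∈ G.touchF U, (bern E p).real (G.TwoArm U e)) :
    m * (p₁ - p₀) ≤ B.card := by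
  classical
  set g : (E → Bool) → ℝ := fun ω => (G.traces B (opn ω ∩ G.touch U)).card with hg
  have hgdep : DependsOn g (G.touchF U : Set E) := by
    rw [coe_touchF]
    intro ω ω' h
    have : opn ω ∩ G.touch U = opn ω' ∩ G.touch U := by
      ext f
      simp only [opn, Set.mem_inter_iff, Set.mem_ofPred_eq]
      exact and_congr_left fun hf => by rw [h f hf]
    simp only [hg, this]
  have htdep : ∀ e, DependsOn (· ∈ G.TwoArm (U : Set V) e) (G.touchF U : Set E) := fun e => by
    rw [coe_touchF]; exact dependsOn_twoArm _ _
  have hle : ∀ (ω : E → Bool) e, Function.update ω e false ≤ Function.update ω e true :=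
    fun ω e => update_le_update_iff.2 ⟨by simp, fun _ _ => le_rfl⟩
  have hinf : ∀ e ∈ G.touchF U, ∀ ω, influence e g ω ≤ - one (G.TwoArm (U : Set V) e) ω := by
    intro e he ω
    rw [mem_touchF] at he
    have hsub : opn (Function.update ω e false) ∩ G.touch (U : Set V) ⊆
        opn (Function.update ω e true) ∩ G.touch (U : Set V) :=
      Set.inter_subset_inter_left _ (opn_mono (hle ω e))
    by_cases hω : ω ∈ G.TwoArm (U : Set V) e
    · have hK : (opn ω ∩ G.touch (U : Set V)) \ {e} =
          opn (Function.update ω e false) ∩ G.touch (U : Set V) := by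
        ext f
        by_cases hf : f = e
        · subst hf; simp [opn]
        · simp [opn, hf]
      rw [one, Set.indicator_of_mem hω]
      obtain ⟨x, y, hj, ⟨z, hz, hxz⟩, ⟨w, hw, hyw⟩, hxy⟩ := hω
      rw [hK] at hxz hyw hxy
      have hmemB : ∀ {x y z : V}, G.Joins e x y → z ∉ (U : Set V) →
          G.Conn (opn (Function.update ω e false) ∩ G.touch (U : Set V)) x z → z ∈ B := by
        intro x y z hj hz hc
        rcases Relation.ReflTransGen.cases_tail hc with rfl | ⟨u, -, f, hf, hj'⟩
        · exact hB e he _ _ hj hz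
        · exact hB f hf.2 _ _ hj'.symm hz
      have hlt := card_traces_lt (G := G) B hsub (hmemB hj hz hxz) (hmemB hj.symm hw hyw)
        (fun h => hxy (hxz.trans (h.trans hyw.symm)))
        (((hxz.mono hsub).symm.trans
          (hj.conn (K := opn (Function.update ω e true) ∩ G.touch (U : Set V))
            ⟨by simp [opn], he⟩)).trans (hyw.mono hsub))
      have hlt' : ((G.traces B (opn (Function.update ω e true) ∩ G.touch U)).card : ℝ) + 1 ≤
          (G.traces B (opn (Function.update ω e false) ∩ G.touch U)).card := by
        exact_mod_cast hlt
      simp only [influence, hg, Pi.one_apply]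
      linarith
    · rw [one, Set.indicator_of_notMem hω]
      have := card_traces_le (G := G) B hsub
      simp only [influence, hg]
      have h' : ((G.traces B (opn (Function.update ω e true) ∩ G.touch U)).card : ℝ) ≤
          (G.traces B (opn (Function.update ω e false) ∩ G.touch U)).card := by
        exact_mod_cast this
      linarith
  set f : ℝ → ℝ := fun p => Ex (G.touchF U) p g with hf
  have hd : ∀ p, HasDerivAt f (∑ e ∈ G.touchF U, Ex (G.touchF U) p (influence e g)) p :=
    fun p => hasDerivAt_Ex _ _ p
  have hmvt := (convex_Icc (p₀ : ℝ) p₁).image_sub_le_mul_sub_of_deriv_le (f := f) (C := -m)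
    (fun x _ => (hd x).continuousAt.continuousWithinAt)
    (fun x _ => (hd x).differentiableAt.differentiableWithinAt) (by
      intro x hx
      rw [interior_Icc] at hx
      have hx01 : x ∈ unitInterval := ⟨p₀.2.1.trans hx.1.le, hx.2.le.trans p₁.2.2⟩
      have h1 := hm ⟨x, hx01⟩ (Subtype.coe_le_coe.1 hx.1.le) (Subtype.coe_le_coe.1 hx.2.le)
      rw [(hd x).deriv]
      refine le_trans ?_ (neg_le_neg h1)
      rw [← Finset.sum_neg_distrib]
      refine Finset.sum_le_sum fun e he => ?_
      rw [← integral_one (htdep e), ← integral_neg]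
      have h2 := integral_eq_Ex (dependsOn_influence hgdep e) ⟨x, hx01⟩
      simp only at h2
      rw [← h2]
      exact integral_mono (integrable_of_dependsOn (dependsOn_influence hgdep e) _)
        (integrable_of_dependsOn (dependsOn_one (htdep e)) _).neg (hinf e he))
    p₀ (Set.left_mem_Icc.2 h01) p₁ (Set.right_mem_Icc.2 h01) h01
  have hf1 : 0 ≤ f p₁ := by
    change 0 ≤ Ex _ _ _
    rw [← integral_eq_Ex hgdep]
    exact integral_nonneg fun ω => Nat.cast_nonneg _
  have hf0 : f p₀ ≤ B.card := by
    change Ex _ _ _ ≤ _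
    rw [← integral_eq_Ex hgdep]
    refine (integral_mono (integrable_of_dependsOn hgdep _) (integrable_const (B.card : ℝ))
      fun ω => ?_).trans_eq (by simp)
    exact Nat.cast_le.2 Finset.card_image_le
  linarith

end EdgeGraph

open EdgeGraph

/-! ### The square lattice in coordinates -/

/-- A bond of the square lattice in coordinates: `((x, y), false)` is the horizontal bond from
`(x, y)` to `(x + 1, y)`, and `((x, y), true)` the vertical bond from `(x, y)` to `(x, y + 1)`. -/
abbrev GridEdge : Type := (ℤ × ℤ) × Bool

/-- The second end of a bond. -/
def gridTgt (e : GridEdge) : ℤ × ℤ := if e.2 then (e.1.1, e.1.2 + 1) else (e.1.1 + 1, e.1.2)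

@[simp] lemma gridTgt_false (v : ℤ × ℤ) : gridTgt (v, false) = (v.1 + 1, v.2) := rfl

@[simp] lemma gridTgt_true (v : ℤ × ℤ) : gridTgt (v, true) = (v.1, v.2 + 1) := rfl

/-- The square lattice. -/
def grid : EdgeGraph (ℤ × ℤ) GridEdge where
  src e := e.1
  tgt := gridTgt
  finite_inc v := by
    refine ((Set.finite_Icc (v.1 - 1, v.2 - 1) v).prod (Set.finite_univ (α := Bool))).subset ?_
    rintro ⟨⟨x, y⟩, d⟩ h
    simp only [Set.mem_prod, Set.mem_univ, and_true, Set.mem_Icc, Prod.le_def]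
    cases d <;> rcases h with rfl | rfl <;> simp

@[simp] lemma grid_src (e : GridEdge) : grid.src e = e.1 := rfl

@[simp] lemma grid_tgt (e : GridEdge) : grid.tgt e = gridTgt e := rfl

lemma joins_h (x y : ℤ) : grid.Joins ((x, y), false) (x, y) (x + 1, y) := Or.inl ⟨rfl, rfl⟩

lemma joins_v (x y : ℤ) : grid.Joins ((x, y), true) (x, y) (x, y + 1) := Or.inl ⟨rfl, rfl⟩

lemma conn_row {K : Set GridEdge} {x x' y : ℤ} (hx : x ≤ x')
    (h : ∀ t, x ≤ t → t < x' → ((t, y), false) ∈ K) : grid.Conn K (x, y) (x', y) := by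
  induction x', hx using Int.leInduction with
  | base => exact Conn.refl _
  | succ n hn ih =>
    exact (ih fun t h1 h2 => h t h1 (by omega)).trans ((joins_h n y).conn (h n hn (by omega)))

lemma conn_col {K : Set GridEdge} {x y y' : ℤ} (hy : y ≤ y')
    (h : ∀ t, y ≤ t → t < y' → ((x, t), true) ∈ K) : grid.Conn K (x, y) (x, y') := by
  induction y', hy using Int.leInduction with
  | base => exact Conn.refl _
  | succ n hn ih =>
    exact (ih fun t h1 h2 => h t h1 (by omega)).trans ((joins_v x n).conn (h n hn (by omega)))

/-- The square `[a, b] × [a, b]`. -/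
noncomputable def sqr (a b : ℤ) : Finset (ℤ × ℤ) := Finset.Icc a b ×ˢ Finset.Icc a b

/-- The square of radius `n` around `v`. -/
noncomputable def ball (v : ℤ × ℤ) (n : ℤ) : Finset (ℤ × ℤ) :=
  Finset.Icc (v.1 - n) (v.1 + n) ×ˢ Finset.Icc (v.2 - n) (v.2 + n)

lemma mem_sqr {a b : ℤ} {x : ℤ × ℤ} :
    x ∈ sqr a b ↔ (a ≤ x.1 ∧ x.1 ≤ b) ∧ (a ≤ x.2 ∧ x.2 ≤ b) := by
  simp [sqr, Finset.mem_product]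

lemma mem_ball {v : ℤ × ℤ} {n : ℤ} {x : ℤ × ℤ} :
    x ∈ ball v n ↔ (v.1 - n ≤ x.1 ∧ x.1 ≤ v.1 + n) ∧ (v.2 - n ≤ x.2 ∧ x.2 ≤ v.2 + n) := by
  simp [ball, Finset.mem_product]

lemma ball_zero (n : ℤ) : ball 0 n = sqr (-n) n := by
  ext x; simp [mem_ball, mem_sqr]

/-! ### Symmetries -/

/-- A symmetry of a graph, given by its action on the vertices and on the edges. -/
structure GraphAut {V E : Type*} (G : EdgeGraph V E) where
  vert : V ≃ V
  edge : E ≃ E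
  joins : ∀ e x y, G.Joins e x y → G.Joins (edge e) (vert x) (vert y)
  joins_symm : ∀ e x y, G.Joins (edge e) x y → G.Joins e (vert.symm x) (vert.symm y)

namespace GraphAut

variable {V E : Type*} {G : EdgeGraph V E} (T : GraphAut G)

lemma conn {K K' : Set E} (hK : ∀ e, e ∈ K → T.edge e ∈ K') {x y : V} (h : G.Conn K x y) :
    G.Conn K' (T.vert x) (T.vert y) := by
  induction h with
  | refl => exact Conn.refl _
  | tail _ h ih =>
    obtain ⟨e, he, hj⟩ := h
    exact ih.trans ((T.joins _ _ _ hj).conn (hK e he))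

lemma conn_symm {K K' : Set E} (hK : ∀ e, T.edge e ∈ K' → e ∈ K) {x y : V} (h : G.Conn K' x y) :
    G.Conn K (T.vert.symm x) (T.vert.symm y) := by
  induction h with
  | refl => exact Conn.refl _
  | tail _ h ih =>
    obtain ⟨e, he, hj⟩ := h
    rw [← T.edge.apply_symm_apply e] at hj he
    exact ih.trans ((T.joins_symm _ _ _ hj).conn (hK _ he))

lemma mem_touch_iff {U W : Set V} (hUW : ∀ x, T.vert x ∈ W ↔ x ∈ U) (e : E) :
    T.edge e ∈ G.touch W ↔ e ∈ G.touch U := by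
  have h := joins_src_tgt (G := G) e
  rw [h.mem_touch, (T.joins _ _ _ h).mem_touch, hUW, hUW]

/-- A symmetry carries exits of `U` to exits of its image `W`. -/
lemma exit_iff {U W : Set V} (hUW : ∀ x, T.vert x ∈ W ↔ x ∈ U) (x : V) (ω : E → Bool) :
    (fun e => ω (T.edge e)) ∈ G.Exit U x ↔ ω ∈ G.Exit W (T.vert x) := by
  constructor
  · rintro ⟨z, hz, hc⟩
    exact ⟨T.vert z, (hUW z).not.2 hz, T.conn (fun e he => he) hc⟩
  · rintro ⟨z, hz, hc⟩
    refine ⟨T.vert.symm z, ?_, ?_⟩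
    · rw [← hUW, Equiv.apply_symm_apply]; exact hz
    · have := T.conn_symm (K := opn fun e => ω (T.edge e)) (fun e he => he) hc
      rwa [Equiv.symm_apply_apply] at this

lemma twoArm_iff {U W : Set V} (hUW : ∀ x, T.vert x ∈ W ↔ x ∈ U) (e : E) (ω : E → Bool) :
    (fun e => ω (T.edge e)) ∈ G.TwoArm U e ↔ ω ∈ G.TwoArm W (T.edge e) := by
  have hK : ∀ f, f ∈ (opn (fun e => ω (T.edge e)) ∩ G.touch U) \ {e} ↔
      T.edge f ∈ (opn ω ∩ G.touch W) \ {T.edge e} := by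
    intro f
    simp only [Set.mem_sdiff, Set.mem_inter_iff, Set.mem_singleton_iff, T.mem_touch_iff hUW,
      EmbeddingLike.apply_eq_iff_eq, opn, Set.mem_ofPred_eq]
  have hc : ∀ x y, G.Conn ((opn (fun e => ω (T.edge e)) ∩ G.touch U) \ {e}) x y ↔
      G.Conn ((opn ω ∩ G.touch W) \ {T.edge e}) (T.vert x) (T.vert y) := by
    intro x y
    refine ⟨T.conn fun f => (hK f).1, fun h => ?_⟩
    have := T.conn_symm (fun f => (hK f).2) h
    rwa [Equiv.symm_apply_apply, Equiv.symm_apply_apply] at this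
  constructor
  · rintro ⟨x, y, hj, ⟨z, hz, hxz⟩, ⟨w, hw, hyw⟩, hxy⟩
    exact ⟨T.vert x, T.vert y, T.joins _ _ _ hj, ⟨T.vert z, (hUW z).not.2 hz, (hc _ _).1 hxz⟩,
      ⟨T.vert w, (hUW w).not.2 hw, (hc _ _).1 hyw⟩, fun h => hxy ((hc _ _).2 h)⟩
  · rintro ⟨x, y, hj, ⟨z, hz, hxz⟩, ⟨w, hw, hyw⟩, hxy⟩
    refine ⟨T.vert.symm x, T.vert.symm y, T.joins_symm _ _ _ hj, ⟨T.vert.symm z, ?_, ?_⟩,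
      ⟨T.vert.symm w, ?_, ?_⟩, ?_⟩
    · rw [← hUW, Equiv.apply_symm_apply]; exact hz
    · rw [hc]; simpa using hxz
    · rw [← hUW, Equiv.apply_symm_apply]; exact hw
    · rw [hc]; simpa using hyw
    · rw [hc]; simpa using hxy

end GraphAut

/-- The translation by `a`. -/
def shift (a : ℤ × ℤ) : GraphAut grid where
  vert := Equiv.addRight a
  edge := (Equiv.addRight a).prodCongr (Equiv.refl Bool)
  joins := by
    rintro ⟨⟨x, y⟩, d⟩ v w h
    cases d <;> rcases h with ⟨rfl, rfl⟩ | ⟨rfl, rfl⟩ <;> [left; right; left; right] <;>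
      simp [Prod.ext_iff] <;> ring
  joins_symm := by
    rintro ⟨⟨x, y⟩, d⟩ v w h
    cases d <;> rcases h with ⟨rfl, rfl⟩ | ⟨rfl, rfl⟩ <;> [left; right; left; right] <;>
      simp [Prod.ext_iff] <;> ring

/-- The rotation by a right angle about the point `(s / 2, s / 2)`. -/
def rotate (s : ℤ) : GraphAut grid where
  vert :=
    { toFun := fun v => (s - v.2, v.1)
      invFun := fun v => (v.2, s - v.1)
      left_inv := fun v => by ext <;> simp
      right_inv := fun v => by ext <;> simp }
  edge :=
    { toFun := fun e => if e.2 then ((s - e.1.2 - 1, e.1.1), false) else ((s - e.1.2, e.1.1), true)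
      invFun := fun e => if e.2 then ((e.1.2, s - e.1.1), false) else ((e.1.2, s - 1 - e.1.1), true)
      left_inv := by rintro ⟨⟨x, y⟩, d⟩; cases d <;> simp
      right_inv := by rintro ⟨⟨x, y⟩, d⟩; cases d <;> simp; ring }
  joins := by
    rintro ⟨⟨x, y⟩, d⟩ v w h
    cases d <;> rcases h with ⟨rfl, rfl⟩ | ⟨rfl, rfl⟩
    · left; simp
    · right; simp
    · right; simp [Prod.ext_iff]; ring
    · left; simp [Prod.ext_iff]; ring
  joins_symm := by
    rintro ⟨⟨x, y⟩, d⟩ v w h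
    cases d <;> rcases h with ⟨rfl, rfl⟩ | ⟨rfl, rfl⟩
    · left; simp
    · right; simp
    · right; simp [Prod.ext_iff]; ring
    · left; simp [Prod.ext_iff]; ring

/-! ### Planar duality modulo two -/

/-- The dual bond of `e`. The faces of the lattice are labelled by their lower left corners, so that
they form a copy of the same lattice, and the dual bond joins the two faces next to `e`. -/
def dualEdge : GridEdge ≃ GridEdge where
  toFun e := if e.2 then ((e.1.1 - 1, e.1.2), false) else ((e.1.1, e.1.2 - 1), true)
  invFun e := if e.2 then ((e.1.1, e.1.2 + 1), false) else ((e.1.1 + 1, e.1.2), true)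
  left_inv := by rintro ⟨⟨x, y⟩, d⟩; cases d <;> simp
  right_inv := by rintro ⟨⟨x, y⟩, d⟩; cases d <;> simp

@[simp] lemma dualEdge_h (x y : ℤ) : dualEdge ((x, y), false) = ((x, y - 1), true) := rfl

@[simp] lemma dualEdge_v (x y : ℤ) : dualEdge ((x, y), true) = ((x - 1, y), false) := rfl

@[simp] lemma dualEdge_symm_v (x y : ℤ) : dualEdge.symm ((x, y), true) = ((x, y + 1), false) := rfl

/-- The dual configuration: a dual bond is open if the bond that it crosses is closed. -/
def dualCfg (ω : GridEdge → Bool) : GridEdge → Bool := fun e => !ω (dualEdge.symm e)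

/-- On a rectangle, a function on the bonds that sums to zero around each face is a gradient. -/
lemma exists_potential (c : GridEdge → ZMod 2) (a b l u : ℤ)
    (hc : ∀ x y, a ≤ x → x < b → l ≤ y → y < u →
      c ((x, y), false) + c ((x, y + 1), false) + c ((x, y), true) + c ((x + 1, y), true) = 0) :
    ∃ χ : ℤ × ℤ → ZMod 2,
      (∀ x y, a ≤ x → x < b → l ≤ y → y ≤ u → χ (x + 1, y) = χ (x, y) + c ((x, y), false)) ∧
      (∀ x y, a ≤ x → x ≤ b → l ≤ y → y < u → χ (x, y + 1) = χ (x, y) + c ((x, y), true)) := by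
  set χ : ℤ × ℤ → ZMod 2 := fun v =>
    ∑ t ∈ Finset.Ico a v.1, c ((t, l), false) + ∑ t ∈ Finset.Ico l v.2, c ((v.1, t), true) with hχ
  have hIco : ∀ (f : ℤ → ZMod 2) (m n : ℤ), m ≤ n →
      ∑ t ∈ Finset.Ico m (n + 1), f t = ∑ t ∈ Finset.Ico m n, f t + f n := by
    intro f m n hmn
    have : Finset.Ico m (n + 1) = insert n (Finset.Ico m n) := by
      ext t; simp only [Finset.mem_Ico, Finset.mem_insert]; omega
    rw [this, Finset.sum_insert (by simp), add_comm]
  have hv : ∀ x y, l ≤ y → χ (x, y + 1) = χ (x, y) + c ((x, y), true) := by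
    intro x y hy
    simp only [hχ]
    rw [hIco _ _ _ hy, add_assoc]
  refine ⟨χ, fun x y hx hxb hy => ?_, fun x y _ _ hy _ => hv x y hy⟩
  induction y, hy using Int.leInduction with
  | base =>
    intro _
    simp only [hχ, Finset.Ico_self, Finset.sum_empty, add_zero]
    exact hIco _ _ _ hx
  | succ y hy ih =>
    intro hyu
    have h1 := hc x y hx hxb hy (by omega)
    rw [hv _ _ hy, hv _ _ hy, ih (by omega)]
    have h2 : c ((x, y), false) + c ((x + 1, y), true) =
        c ((x, y + 1), false) + c ((x, y), true) := by
      rw [← sub_eq_zero, CharTwo.sub_eq_add, ← h1]; ring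
    rw [add_assoc, h2]; ring

/-- The boundary modulo two of a chain of bonds. -/
def bdry (c : GridEdge → ZMod 2) (v : ℤ × ℤ) : ZMod 2 :=
  c (v, false) + c ((v.1 - 1, v.2), false) + c (v, true) + c ((v.1, v.2 - 1), true)

/-- The chain that consists of the vertex `v`. -/
def point (v : ℤ × ℤ) : ℤ × ℤ → ZMod 2 := Pi.single v 1

lemma bdry_single (e : GridEdge) (v : ℤ × ℤ) :
    bdry (Pi.single e 1) v = point e.1 v + point (gridTgt e) v := by
  obtain ⟨⟨x, y⟩, d⟩ := e
  obtain ⟨u, w⟩ := v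
  cases d
  · have h1 : (u - 1 = x ∧ w = y) ↔ (u = x + 1 ∧ w = y) := by omega
    simp [bdry, point, Pi.single_apply, Prod.ext_iff, h1]
  · have h1 : (u = x ∧ w - 1 = y) ↔ (u = x ∧ w = y + 1) := by omega
    simp [bdry, point, Pi.single_apply, Prod.ext_iff, h1]

lemma bdry_add (c c' : GridEdge → ZMod 2) (v : ℤ × ℤ) :
    bdry (c + c') v = bdry c v + bdry c' v := by
  simp only [bdry, Pi.add_apply]; ring

/-- A path is a chain whose boundary consists of its two ends. -/
lemma exists_chain_of_conn {K : Set GridEdge} {v w : ℤ × ℤ} (h : grid.Conn K v w) :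
    ∃ c : GridEdge → ZMod 2, (∀ e, c e ≠ 0 → e ∈ K) ∧
      ∀ x, bdry c x = point v x + point w x := by
  induction h with
  | refl =>
    refine ⟨0, fun e he => absurd rfl he, fun x => ?_⟩
    rw [CharTwo.add_self_eq_zero]; simp [bdry]
  | tail _ h ih =>
    obtain ⟨c, hc, hb⟩ := ih
    obtain ⟨e, he, hj⟩ := h
    refine ⟨c + Pi.single e 1, fun f hf => ?_, fun x => ?_⟩
    · by_cases hfe : f = e
      · exact hfe ▸ he
      · exact hc f (by simpa [hfe] using hf)
    · rw [bdry_add, hb, bdry_single]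
      have h2 := fun x : ZMod 2 => CharTwo.add_self_eq_zero x
      rcases hj with ⟨h, h'⟩ | ⟨h, h'⟩ <;> simp only [grid_src, grid_tgt] at h h' <;> subst h <;>
        subst h'
      · linear_combination h2 (point e.1 x)
      · linear_combination h2 (point (gridTgt e) x)

/-- A potential, with its increments stated bond by bond. -/
lemma exists_potential_sqr (c : GridEdge → ZMod 2) (a b : ℤ)
    (hc : ∀ x y, (x, y) ∈ sqr a (b - 1) →
      c ((x, y), false) + c ((x, y + 1), false) + c ((x, y), true) + c ((x + 1, y), true) = 0) :
    ∃ χ : ℤ × ℤ → ZMod 2, ∀ e ∈ grid.inside (sqr a b : Set (ℤ × ℤ)), ∀ x y, grid.Joins e x y →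
      χ y = χ x + c e := by
  obtain ⟨χ, h1, h2⟩ := exists_potential c a b a b fun x y h1 h2 h3 h4 =>
    hc x y (mem_sqr.2 ⟨⟨h1, by simp only; omega⟩, h3, by simp only; omega⟩)
  refine ⟨χ, ?_⟩
  have key : ∀ e ∈ grid.inside (sqr a b : Set (ℤ × ℤ)), χ (gridTgt e) = χ e.1 + c e := by
    rintro ⟨⟨x, y⟩, d⟩ ⟨hs, ht⟩
    rw [Finset.mem_coe, mem_sqr] at hs ht
    cases d
    · simp only [grid_src, grid_tgt, gridTgt_false] at hs ht ⊢
      exact h1 x y hs.1.1 (by omega) hs.2.1 hs.2.2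
    · simp only [grid_src, grid_tgt, gridTgt_true] at hs ht ⊢
      exact h2 x y hs.1.1 hs.1.2 hs.2.1 (by omega)
  rintro e he x y (⟨rfl, rfl⟩ | ⟨rfl, rfl⟩)
  · exact key e he
  · simp only [grid_src, grid_tgt, key e he, add_assoc, CharTwo.add_self_eq_zero, add_zero]

/-- The two ends of a bond `e` are not joined in a square by bonds that avoid a dual path through
`e` with both ends outside of the square. -/
lemma not_conn_of_dual {a b : ℤ} {K L : Set GridEdge} {e : GridEdge} {x y f g z z' : ℤ × ℤ}
    (hK : K ⊆ grid.inside (sqr a b : Set (ℤ × ℤ))) (hKL : ∀ e ∈ K, dualEdge e ∉ L) (heK : e ∉ K)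
    (heL : dualEdge e ∉ L) (he : e ∈ grid.inside (sqr a b : Set (ℤ × ℤ)))
    (hxy : grid.Joins e x y) (hfg : grid.Joins (dualEdge e) f g)
    (hz : z ∉ sqr a (b - 1)) (hz' : z' ∉ sqr a (b - 1))
    (hzf : grid.Conn L z f) (hgz : grid.Conn L g z') : ¬ grid.Conn K x y := by
  intro hcon
  obtain ⟨c₁, hc₁, hb₁⟩ := exists_chain_of_conn hzf
  obtain ⟨c₂, hc₂, hb₂⟩ := exists_chain_of_conn hgz
  have h2 := fun x : ZMod 2 => CharTwo.add_self_eq_zero x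
  -- the dual path through `e`, as a chain whose boundary lies outside of the square
  set C : GridEdge → ZMod 2 := c₁ + c₂ + Pi.single (dualEdge e) 1 with hC
  have hb : ∀ v, bdry C v = point z v + point z' v := by
    intro v
    rw [hC, bdry_add, bdry_add, hb₁, hb₂, bdry_single]
    rcases hfg with ⟨hf, hg⟩ | ⟨hf, hg⟩ <;> simp only [grid_src, grid_tgt] at hf hg <;>
      rw [hf, hg] <;> linear_combination h2 (point f v) + h2 (point g v)
  have hCL : ∀ d, d ∉ L → d ≠ dualEdge e → C d = 0 := by
    intro d hd hde
    have h3 : c₁ d = 0 := by_contra fun h => hd (hc₁ d h)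
    have h4 : c₂ d = 0 := by_contra fun h => hd (hc₂ d h)
    simp [hC, h3, h4, hde]
  have hCe : C (dualEdge e) = 1 := by
    have h3 : c₁ (dualEdge e) = 0 := by_contra fun h => heL (hc₁ _ h)
    have h4 : c₂ (dualEdge e) = 0 := by_contra fun h => heL (hc₂ _ h)
    simp [hC, h3, h4]
  obtain ⟨χ, hχ⟩ := exists_potential_sqr (fun e => C (dualEdge e)) a b (by
    intro x y hxy
    have h3 := hb (x, y)
    have h4 : point z (x, y) = 0 := by
      rw [point, Pi.single_apply, if_neg]; rintro rfl; exact hz hxy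
    have h5 : point z' (x, y) = 0 := by
      rw [point, Pi.single_apply, if_neg]; rintro rfl; exact hz' hxy
    rw [h4, h5, add_zero] at h3
    simp only [dualEdge_h, dualEdge_v, add_sub_cancel_right]
    rw [← h3, bdry]
    ring)
  -- the potential is constant along `K`, but differs between the two ends of `e`
  have hconst : ∀ w, grid.Conn K x w → χ w = χ x := by
    intro w hw
    induction hw with
    | refl => rfl
    | tail _ h ih =>
      obtain ⟨d, hd, hj⟩ := h
      rw [hχ d (hK hd) _ _ hj, hCL _ (hKL d hd), add_zero, ih]
      exact fun h => heK (dualEdge.injective h ▸ hd)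
  have := hχ e he x y hxy
  rw [hconst y hcon, hCe] at this
  simp at this

/-- If no open path crosses a rectangle from left to right, then an open path of the dual
configuration leads from its top to its bottom. -/
lemma exists_dual_crossing {a b l u : ℤ} (hab : a < b) (hlu : l ≤ u) (ω : GridEdge → Bool)
    (hno : ∀ v w, v.1 = a → w.1 = b → v ∈ Set.Icc a b ×ˢ Set.Icc l u →
      ¬ grid.Conn (opn ω ∩ grid.inside (Set.Icc a b ×ˢ Set.Icc l u)) v w) :
    ∃ i j, a ≤ i ∧ i < b ∧ grid.Conn (opn (dualCfg ω)) (i, u) (j, l - 1) := by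
  classical
  by_contra hcon
  push Not at hcon
  set R : Set (ℤ × ℤ) := Set.Icc a b ×ˢ Set.Icc l u with hR
  set A : Set (ℤ × ℤ) := {v | ∃ w ∈ R, w.1 = a ∧ grid.Conn (opn ω ∩ grid.inside R) w v} with hA
  set χA : ℤ × ℤ → ZMod 2 := A.indicator 1 with hχA
  set F : Set (ℤ × ℤ) := {f | ∃ i, a ≤ i ∧ i < b ∧ grid.Conn (opn (dualCfg ω)) (i, u) f} with hF
  have memR : ∀ x y : ℤ, (x, y) ∈ R ↔ (a ≤ x ∧ x ≤ b) ∧ (l ≤ y ∧ y ≤ u) := by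
    intro x y; simp [hR]; tauto
  have h2 := fun x : ZMod 2 => CharTwo.add_self_eq_zero x
  -- a bond of the rectangle with exactly one end in `A` is closed
  have hcut : ∀ e ∈ grid.inside R, ∀ f g, grid.Joins (dualEdge e) f g → f ∈ F →
      χA e.1 + χA (gridTgt e) ≠ 0 → g ∈ F := by
    rintro e he f g hj ⟨i, hi, hib, hif⟩ hne
    refine ⟨i, hi, hib, hif.trans (hj.conn ?_)⟩
    by_contra hopen
    have hopen' : e ∈ opn ω ∩ grid.inside R := by
      refine ⟨?_, he⟩
      simpa [opn, dualCfg] using hopen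
    apply hne
    have hiff : e.1 ∈ A ↔ gridTgt e ∈ A := by
      constructor
      · rintro ⟨w, hw, hwa, hc⟩
        exact ⟨w, hw, hwa, hc.trans ((joins_src_tgt (G := grid) e).conn hopen')⟩
      · rintro ⟨w, hw, hwa, hc⟩
        exact ⟨w, hw, hwa, hc.trans ((joins_src_tgt (G := grid) e).symm.conn hopen')⟩
    by_cases h : e.1 ∈ A
    · simp only [hχA, Set.indicator_of_mem h, Set.indicator_of_mem (hiff.1 h)]
      exact h2 1
    · simp [hχA, Set.indicator_of_notMem h, Set.indicator_of_notMem (hiff.not.1 h)]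
  -- the cut between `A` and its complement, kept only where its dual bonds lie in `F`: it is closed
  -- at every face, since by `hcut` either all or none of the cut bonds around a face are kept
  set m : GridEdge → ZMod 2 := fun e =>
    if (dualEdge e).1 ∈ F then χA e.1 + χA (gridTgt e) else 0 with hm
  have hm1 : ∀ e ∈ grid.inside R, ∀ f g, grid.Joins (dualEdge e) f g →
      m e = if f ∈ F then χA e.1 + χA (gridTgt e) else 0 := by
    intro e he f g hj
    by_cases h0 : χA e.1 + χA (gridTgt e) = 0
    · simp [hm, h0]
    · have : (dualEdge e).1 ∈ F ↔ f ∈ F := by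
        have hs := joins_src_tgt (G := grid) (dualEdge e)
        rcases hj with ⟨rfl, rfl⟩ | ⟨rfl, rfl⟩
        · rfl
        · exact ⟨fun h => hcut e he _ _ hs h h0, fun h => hcut e he _ _ hs.symm h h0⟩
      simp only [hm, this]
  have hmh : ∀ x y, (x, y) ∈ R → (x + 1, y) ∈ R → (m ((x, y), false) =
      if (x, y) ∈ F then χA (x, y) + χA (x + 1, y) else 0) ∧ (m ((x, y), false) =
      if (x, y - 1) ∈ F then χA (x, y) + χA (x + 1, y) else 0) := by
    intro x y h h'
    have hj : grid.Joins (dualEdge ((x, y), false)) (x, y - 1) (x, y) := by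
      have := joins_v x (y - 1)
      rwa [sub_add_cancel] at this
    exact ⟨hm1 ((x, y), false) ⟨h, h'⟩ _ _ hj.symm, hm1 ((x, y), false) ⟨h, h'⟩ _ _ hj⟩
  have hmv : ∀ x y, (x, y) ∈ R → (x, y + 1) ∈ R → (m ((x, y), true) =
      if (x, y) ∈ F then χA (x, y) + χA (x, y + 1) else 0) ∧ (m ((x, y), true) =
      if (x - 1, y) ∈ F then χA (x, y) + χA (x, y + 1) else 0) := by
    intro x y h h'
    have hj : grid.Joins (dualEdge ((x, y), true)) (x - 1, y) (x, y) := by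
      have := joins_h (x - 1) y
      rwa [sub_add_cancel] at this
    exact ⟨hm1 ((x, y), true) ⟨h, h'⟩ _ _ hj.symm, hm1 ((x, y), true) ⟨h, h'⟩ _ _ hj⟩
  obtain ⟨χ, hχh, hχv⟩ := exists_potential m a b l u (by
    intro x y h1 h3 h4 h5
    have e1 := (hmh x y (by rw [memR]; omega) (by rw [memR]; omega)).1
    have e2 := (hmh x (y + 1) (by rw [memR]; omega) (by rw [memR]; omega)).2
    have e3 := (hmv x y (by rw [memR]; omega) (by rw [memR]; omega)).1
    have e4 := (hmv (x + 1) y (by rw [memR]; omega) (by rw [memR]; omega)).2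
    rw [add_sub_cancel_right] at e2 e4
    rw [e1, e2, e3, e4]
    by_cases hf : (x, y) ∈ F
    · simp only [hf, if_true]
      linear_combination h2 (χA (x, y)) + h2 (χA (x + 1, y)) + h2 (χA (x, y + 1)) +
        h2 (χA (x + 1, y + 1))
    · simp [hf])
  -- along the boundary of the rectangle, `m` sums to one over the top row, which lies in `F`, and to
  -- zero over the bottom row and over the two sides, so that it cannot be a gradient
  have hleft : ∀ y, l ≤ y → y ≤ u → χA (a, y) = 1 := by
    intro y h1 h3
    have : (a, y) ∈ A := ⟨(a, y), by rw [memR]; omega, rfl, Conn.refl _⟩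
    simp [hχA, this]
  have hright : ∀ y, l ≤ y → y ≤ u → χA (b, y) = 0 := by
    intro y h1 h3
    have : (b, y) ∉ A := by
      rintro ⟨w, hw, hwa, hc⟩
      exact hno w (b, y) hwa rfl hw hc
    simp [hχA, this]
  have htop : ∀ x, a ≤ x → x ≤ b → χ (x, u) + χ (a, u) = χA (x, u) + χA (a, u) := by
    intro x hx
    induction x, hx using Int.leInduction with
    | base => intro _; rw [h2, h2]
    | succ x hx ih =>
      intro hxb
      have hxF : (x, u) ∈ F := ⟨x, hx, by omega, Conn.refl _⟩
      have h3 := (hmh x u (by rw [memR]; omega) (by rw [memR]; omega)).1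
      rw [if_pos hxF] at h3
      rw [hχh x u hx (by omega) hlu le_rfl, h3]
      linear_combination ih (by omega) + h2 (χA (x, u))
  have hbot : ∀ x, a ≤ x → x ≤ b → χ (x, l) = χ (a, l) := by
    intro x hx
    induction x, hx using Int.leInduction with
    | base => intro _; rfl
    | succ x hx ih =>
      intro hxb
      have hxF : (x, l - 1) ∉ F := by
        rintro ⟨i, hi, hib, hc⟩
        exact hcon i x hi hib hc
      have h3 := (hmh x l (by rw [memR]; omega) (by rw [memR]; omega)).2
      rw [if_neg hxF] at h3
      rw [hχh x l hx (by omega) le_rfl hlu, h3, add_zero]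
      exact ih (by omega)
  have hside : ∀ x, a ≤ x → x ≤ b → (∀ y, l ≤ y → y < u → χA (x, y) = χA (x, y + 1)) →
      ∀ y, l ≤ y → y ≤ u → χ (x, y) = χ (x, l) := by
    intro x hx hxb hcol y hy
    induction y, hy using Int.leInduction with
    | base => intro _; rfl
    | succ y hy ih =>
      intro hyu
      have h3 := (hmv x y (by rw [memR]; omega) (by rw [memR]; omega)).1
      rw [hcol y hy (by omega), h2, ite_self] at h3
      rw [hχv x y hx hxb hy (by omega), h3, add_zero]
      exact ih (by omega)
  have s1 := hside a le_rfl hab.le (fun y h1 h3 => by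
    rw [hleft y h1 h3.le, hleft (y + 1) (by omega) (by omega)]) u hlu le_rfl
  have s2 := hside b hab.le le_rfl (fun y h1 h3 => by
    rw [hright y h1 h3.le, hright (y + 1) (by omega) (by omega)]) u hlu le_rfl
  have s3 := htop b hab.le le_rfl
  rw [s1, s2, hbot b hab.le le_rfl, h2, hleft u hlu le_rfl, hright u hlu le_rfl] at s3
  simp at s3

/-! ### Arms from the four sides of a square -/

/-- The event that some vertex of `D` is joined to the outside of `W`. -/
def SetExit (D W : Set (ℤ × ℤ)) : Set (GridEdge → Bool) := {ω | ∃ x ∈ D, ω ∈ grid.Exit W x}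

/-- The event that an open path leads out of `W`, starting with a bond from `[a, b] × [a, b]` to a
vertex in `Q` and then avoiding all bonds that touch the square. -/
def SideArm (a b : ℤ) (W Q : Set (ℤ × ℤ)) : Set (GridEdge → Bool) :=
  {ω | ∃ x y e, x ∈ sqr a b ∧ y ∉ sqr a b ∧ y ∈ Q ∧ grid.Joins e x y ∧ ω e = true ∧
    ω ∈ grid.ExitOff (grid.touch (sqr a b : Set (ℤ × ℤ))) W y}

lemma dependsOn_setExit (D : Set (ℤ × ℤ)) (W : Finset (ℤ × ℤ)) :
    DependsOn (· ∈ SetExit D W) (grid.touchF W : Set GridEdge) := by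
  refine dependsOn_of_imp ?_
  rintro ω ω' h ⟨x, hx, he⟩
  exact ⟨x, hx, (mem_iff_of_dependsOn (dependsOn_exit_touchF W x) h).1 he⟩

lemma isUpperSet_setExit (D W : Set (ℤ × ℤ)) : IsUpperSet (SetExit D W) := by
  rintro ω ω' h ⟨x, hx, he⟩
  exact ⟨x, hx, isUpperSet_exit _ _ h he⟩

lemma dependsOn_sideArm {a b : ℤ} {W : Finset (ℤ × ℤ)} (hW : sqr a b ⊆ W) (Q : Set (ℤ × ℤ)) :
    DependsOn (· ∈ SideArm a b W Q) (grid.touchF W : Set GridEdge) := by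
  refine dependsOn_of_imp ?_
  rintro ω ω' h ⟨x, y, e, hx, hy, hQ, hj, he, hex⟩
  refine ⟨x, y, e, hx, hy, hQ, hj, ?_, ?_⟩
  · rw [← h e (mem_touchF.2 (hj.mem_touch_left (hW hx)))]; exact he
  · refine (mem_iff_of_dependsOn (dependsOn_exitOff _ _ _) fun f hf => h f ?_).1 hex
    exact mem_touchF.2 hf.1

lemma isUpperSet_sideArm (a b : ℤ) (W Q : Set (ℤ × ℤ)) : IsUpperSet (SideArm a b W Q) := by
  rintro ω ω' h ⟨x, y, e, hx, hy, hQ, hj, he, hex⟩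
  exact ⟨x, y, e, hx, hy, hQ, hj, opn_mono h he, isUpperSet_exitOff _ _ _ h hex⟩

lemma setExit_subset {a b : ℤ} {W : Finset (ℤ × ℤ)} (hW : sqr a b ⊆ W) :
    SetExit (sqr a b) W ⊆ (SideArm a b W {v | b < v.1} ∪ SideArm a b W {v | b < v.2}) ∪
      (SideArm a b W {v | v.1 < a} ∪ SideArm a b W {v | v.2 < a}) := by
  rintro ω ⟨x, hx, z, hz, hc⟩
  obtain ⟨u, v, e, hu, hv, he, hj, hc'⟩ := hc.last_exit (C := (sqr a b : Set (ℤ × ℤ)))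
    (fun h => hz (hW h)) hx
  have hmem : ∀ Q : Set (ℤ × ℤ), v ∈ Q → ω ∈ SideArm a b W Q := fun Q hQ =>
    ⟨u, v, e, hu, hv, hQ, hj, he, z, hz, hc'⟩
  have hv' : b < v.1 ∨ b < v.2 ∨ v.1 < a ∨ v.2 < a := by
    rw [Finset.mem_coe, mem_sqr] at hv
    omega
  rcases hv' with h | h | h | h
  · exact Or.inl (Or.inl (hmem _ h))
  · exact Or.inl (Or.inr (hmem _ h))
  · exact Or.inr (Or.inl (hmem _ h))
  · exact Or.inr (Or.inr (hmem _ h))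

/-- A rotation carries arms from one side to arms from the next side. -/
lemma sideArm_rotate_le (p : unitInterval) {a b A B : ℤ} (hAB : A + B = a + b) (hA : A ≤ a)
    (_ : b ≤ B) {Q Q' : Set (ℤ × ℤ)} (hQ : ∀ x ∈ Q, (rotate (a + b)).vert x ∈ Q') :
    (bern GridEdge p).real (SideArm a b (sqr A B : Set (ℤ × ℤ)) Q) ≤
      (bern GridEdge p).real (SideArm a b (sqr A B : Set (ℤ × ℤ)) Q') := by
  have hsub : sqr a b ⊆ sqr A B := by
    intro x hx; rw [mem_sqr] at hx ⊢; omega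
  rw [← bern_reindex (dependsOn_sideArm hsub Q) p (rotate (a + b)).edge]
  refine measureReal_mono ?_ (measure_ne_top _ _)
  have h1 : ∀ x, (rotate (a + b)).vert x ∈ sqr a b ↔ x ∈ sqr a b := by
    intro x; rw [mem_sqr, mem_sqr]; simp only [rotate, Equiv.coe_fn_mk]; omega
  have h2 : ∀ x, (rotate (a + b)).vert x ∈ sqr A B ↔ x ∈ sqr A B := by
    intro x; rw [mem_sqr, mem_sqr]; simp only [rotate, Equiv.coe_fn_mk]; omega
  rintro ω ⟨x, y, e, hx, hy, hyQ, hj, he, z, hz, hc⟩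
  refine ⟨(rotate (a + b)).vert x, (rotate (a + b)).vert y, (rotate (a + b)).edge e, (h1 x).2 hx,
    (h1 y).not.2 hy, hQ y hyQ, (rotate (a + b)).joins _ _ _ hj, he, (rotate (a + b)).vert z,
    (h2 z).not.2 hz, (rotate (a + b)).conn ?_ hc⟩
  rintro f ⟨hf, hft⟩
  exact ⟨hf, fun h => hft (((rotate (a + b)).mem_touch_iff (U := (sqr a b : Set (ℤ × ℤ)))
    (fun x => h1 x) f).1 h)⟩

/-- The square root trick: if a large square is very likely to be joined to far away, then so is
each of its sides. -/
lemma sideArm_bound (p : unitInterval) {a b A B : ℤ} (hAB : A + B = a + b) (hA : A ≤ a)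
    (hB : b ≤ B) (h : 1 - (1 / 8 : ℝ) ^ 4 ≤
      (bern GridEdge p).real (SetExit (sqr a b) (sqr A B : Set (ℤ × ℤ)))) :
    (7 / 8 ≤ (bern GridEdge p).real (SideArm a b (sqr A B : Set (ℤ × ℤ)) {v | b < v.1})) ∧
    (7 / 8 ≤ (bern GridEdge p).real (SideArm a b (sqr A B : Set (ℤ × ℤ)) {v | b < v.2})) ∧
    (7 / 8 ≤ (bern GridEdge p).real (SideArm a b (sqr A B : Set (ℤ × ℤ)) {v | v.1 < a})) ∧
    (7 / 8 ≤ (bern GridEdge p).real (SideArm a b (sqr A B : Set (ℤ × ℤ)) {v | v.2 < a})) := by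
  have hsub : sqr a b ⊆ sqr A B := by
    intro x hx; rw [mem_sqr] at hx ⊢; omega
  have r1 := sideArm_rotate_le p hAB hA hB (Q := {v | b < v.1}) (Q' := {v | b < v.2})
    fun x hx => hx
  have r2 := sideArm_rotate_le p hAB hA hB (Q := {v | b < v.2}) (Q' := {v | v.1 < a})
    fun x hx => by
      simp only [rotate, Equiv.coe_fn_mk, Set.mem_ofPred_eq] at hx ⊢; omega
  have r3 := sideArm_rotate_le p hAB hA hB (Q := {v | v.1 < a}) (Q' := {v | v.2 < a})
    fun x hx => hx
  have r4 := sideArm_rotate_le p hAB hA hB (Q := {v | v.2 < a}) (Q' := {v | b < v.1})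
    fun x hx => by
      simp only [rotate, Equiv.coe_fn_mk, Set.mem_ofPred_eq] at hx ⊢; omega
  have d := fun Q => dependsOn_sideArm hsub Q
  have up := fun Q => isUpperSet_sideArm a b (sqr A B : Set (ℤ × ℤ)) Q
  have f1 := harris_compl (d {v | b < v.1}) (d {v | b < v.2}) (up _) (up _) p
  have f2 := harris_compl (d {v | v.1 < a}) (d {v | v.2 < a}) (up _) (up _) p
  have f3 := harris_compl (dependsOn_union (d {v | b < v.1}) (d {v | b < v.2}))
    (dependsOn_union (d {v | v.1 < a}) (d {v | v.2 < a})) ((up _).union (up _))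
    ((up _).union (up _)) p
  have hle := measureReal_mono (setExit_subset hsub) (μ := bern GridEdge p) (measure_ne_top _ _)
  rw [← Set.compl_union, bern_compl (dependsOn_union (dependsOn_union (d _) (d _))
    (dependsOn_union (d _) (d _))), Set.compl_union, Set.compl_union] at f3
  rw [bern_compl (d _), bern_compl (d _)] at f1 f2
  set q₁ := (bern GridEdge p).real (SideArm a b (sqr A B : Set (ℤ × ℤ)) {v | b < v.1})
  set q₂ := (bern GridEdge p).real (SideArm a b (sqr A B : Set (ℤ × ℤ)) {v | b < v.2})
  set q₃ := (bern GridEdge p).real (SideArm a b (sqr A B : Set (ℤ × ℤ)) {v | v.1 < a})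
  set q₄ := (bern GridEdge p).real (SideArm a b (sqr A B : Set (ℤ × ℤ)) {v | v.2 < a})
  have e2 : q₂ = q₁ := by linarith
  have e3 : q₃ = q₁ := by linarith
  have e4 : q₄ = q₁ := by linarith
  have hq1 : q₁ ≤ 1 := measureReal_le_one
  rw [e2] at f1
  rw [e3, e4] at f2
  have h0 : 0 ≤ (1 - q₁) * (1 - q₁) := mul_self_nonneg _
  have f4 : ((1 - q₁) * (1 - q₁)) * ((1 - q₁) * (1 - q₁)) ≤ (1 / 8 : ℝ) ^ 4 :=
    ((mul_le_mul f1 f2 h0 measureReal_nonneg).trans f3).trans (by linarith)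
  -- the four sides have the same probability, so that `(1 - q₁) ^ 4` bounds the probability that
  -- there is no arm at all from below
  have f5 : 1 - q₁ ≤ 1 / 8 := by
    refine le_of_pow_le_pow_left₀ (n := 4) (by norm_num) (by norm_num) ?_
    calc (1 - q₁) ^ 4 = ((1 - q₁) * (1 - q₁)) * ((1 - q₁) * (1 - q₁)) := by ring
      _ ≤ _ := f4
  rw [e2, e3, e4]
  exact ⟨by linarith, by linarith, by linarith, by linarith⟩

/-! ### From four arms to two arms at a bond -/

/-- The bonds around `[-k, k] × [-k, k]` that are opened in order to turn four arms from the sides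
of the square into two arms at the bond from `(0, 0)` to `(1, 0)`: all but the vertical ones that
lead out of the square, and the horizontal ones between the abscissas `0` and `1`. -/
noncomputable def bridges (k : ℤ) : Finset GridEdge :=
  (grid.touchF (sqr (-k) k)).filter fun e =>
    if e.2 then -k ≤ e.1.2 ∧ e.1.2 < k else e.1.1 ≠ 0

lemma mem_bridges_h {k x y : ℤ} : ((x, y), false) ∈ bridges k ↔
    ((-k - 1 ≤ x ∧ x ≤ k) ∧ -k ≤ y ∧ y ≤ k) ∧ x ≠ 0 := by
  simp only [bridges, Finset.mem_filter, mem_touchF, touch, Set.mem_ofPred_eq, grid_src, grid_tgt,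
    gridTgt_false, Finset.mem_coe, mem_sqr]
  simp only [Bool.false_eq_true, if_false]
  omega

lemma mem_bridges_v {k x y : ℤ} : ((x, y), true) ∈ bridges k ↔
    (-k ≤ x ∧ x ≤ k) ∧ -k ≤ y ∧ y < k := by
  simp only [bridges, Finset.mem_filter, mem_touchF, touch, Set.mem_ofPred_eq, grid_src, grid_tgt,
    gridTgt_true, Finset.mem_coe, mem_sqr]
  simp only [if_true]
  omega

lemma mem_touch_sqr_h {a b x y : ℤ} (hab : a ≤ b) :
    (((x, y), false) : GridEdge) ∈ grid.touch (sqr a b : Set (ℤ × ℤ)) ↔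
      (a - 1 ≤ x ∧ x ≤ b) ∧ a ≤ y ∧ y ≤ b := by
  simp only [touch, Set.mem_ofPred_eq, grid_src, grid_tgt, gridTgt_false, Finset.mem_coe, mem_sqr]
  omega

lemma mem_touch_sqr_v {a b x y : ℤ} (hab : a ≤ b) :
    (((x, y), true) : GridEdge) ∈ grid.touch (sqr a b : Set (ℤ × ℤ)) ↔
      (a ≤ x ∧ x ≤ b) ∧ a - 1 ≤ y ∧ y ≤ b := by
  simp only [touch, Set.mem_ofPred_eq, grid_src, grid_tgt, gridTgt_true, Finset.mem_coe, mem_sqr]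
  omega

lemma modify_apply_of_mem {ι : Type*} {M s : Finset ι} {ω : ι → Bool} {e : ι} (he : e ∈ M) :
    modify M s ω e = true ↔ e ∈ s := by
  simp [modify, he]

lemma modify_apply_of_notMem {ι : Type*} {M s : Finset ι} {ω : ι → Bool} {e : ι} (he : e ∉ M) :
    modify M s ω e = ω e := by
  simp [modify, he]

/-- Four alternating arms from the sides of a square, two of them dual, give two arms at the bond
from `(0, 0)` to `(1, 0)` after a modification of the bonds that touch the square. -/
lemma twoArm_of_four_arms {k N : ℤ} (hk : 1 ≤ k) (hkN : k ≤ N) {ω : GridEdge → Bool}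
    (hR : ω ∈ SideArm (-k) k (sqr (-N) N : Set (ℤ × ℤ)) {v | k < v.1})
    (hL : ω ∈ SideArm (-k) k (sqr (-N) N : Set (ℤ × ℤ)) {v | v.1 < -k})
    (hT : dualCfg ω ∈ SideArm (-k - 1) k (sqr (-N - 1) N : Set (ℤ × ℤ)) {v | k < v.2})
    (hB : dualCfg ω ∈ SideArm (-k - 1) k (sqr (-N - 1) N : Set (ℤ × ℤ)) {v | v.2 < -k - 1}) :
    modify (grid.touchF (sqr (-k) k)) (bridges k) ω ∈
      grid.TwoArm (sqr (-N) N : Set (ℤ × ℤ)) ((0, 0), false) := by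
  set M := grid.touchF (sqr (-k) k) with hM
  set ω' := modify M (bridges k) ω with hω'
  have memM : ∀ e, e ∈ M ↔ e ∈ grid.touch (sqr (-k) k : Set (ℤ × ℤ)) := fun e => mem_touchF
  have hbr : ∀ e, e ∈ bridges k → ω' e = true := fun e he =>
    (modify_apply_of_mem (Finset.mem_filter.1 he).1).2 he
  have hnbr : ∀ e, e ∈ M → e ∉ bridges k → ω' e = false := fun e he hn => by
    rw [← Bool.not_eq_true, hω', modify_apply_of_mem he]; exact hn
  have hout : ∀ e, e ∉ M → ω' e = ω e := fun e he => modify_apply_of_notMem he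
  have he0M : (((0, 0), false) : GridEdge) ∈ M := by
    rw [memM, mem_touch_sqr_h (by omega)]; omega
  set e₀ : GridEdge := ((0, 0), false) with he₀
  have he0b : e₀ ∉ bridges k := by rw [he₀, mem_bridges_h]; omega
  set K : Set GridEdge := opn ω' \ {e₀} with hK
  have hbrK : ∀ e, e ∈ bridges k → e ∈ K := fun e he =>
    ⟨hbr e he, fun h => he0b (h ▸ he)⟩
  have hrest : opn ω \ grid.touch (sqr (-k) k : Set (ℤ × ℤ)) ⊆ K := by
    rintro e ⟨he, heM⟩
    rw [← memM] at heM
    refine ⟨?_, fun h => heM (h ▸ he0M)⟩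
    change ω' e = true
    rw [hout e heM]; exact he
  -- the arms of `ω` from the right and from the left
  have hright : ∃ z, z ∉ (sqr (-N) N : Set (ℤ × ℤ)) ∧ grid.Conn K (1, 0) z := by
    obtain ⟨x, ⟨y₁, y₂⟩, e, hx, -, hyQ, hj, -, z, hz, hc⟩ := hR
    refine ⟨z, hz, Conn.trans ?_ (hc.mono hrest)⟩
    rw [mem_sqr] at hx
    simp only [Set.mem_ofPred_eq] at hyQ
    have hy : y₁ = k + 1 ∧ -k ≤ y₂ ∧ y₂ ≤ k := by
      obtain ⟨⟨u, v⟩, d⟩ := e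
      cases d <;> rcases hj with ⟨h1, h2⟩ | ⟨h1, h2⟩ <;>
        simp only [grid_src, grid_tgt, gridTgt_true, gridTgt_false, Prod.ext_iff] at h1 h2 <;>
        omega
    obtain ⟨rfl, hy1, hy2⟩ := hy
    have hrow : grid.Conn K (1, y₂) (k + 1, y₂) := conn_row (by omega) fun t h1 h2 =>
      hbrK _ (mem_bridges_h.2 (by omega))
    refine Conn.trans ?_ hrow
    rcases le_total 0 y₂ with h | h
    · exact conn_col h fun t h1 h2 => hbrK _ (mem_bridges_v.2 (by omega))
    · exact (conn_col h fun t h1 h2 => hbrK _ (mem_bridges_v.2 (by omega))).symm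
  have hleft : ∃ z, z ∉ (sqr (-N) N : Set (ℤ × ℤ)) ∧ grid.Conn K (0, 0) z := by
    obtain ⟨x, ⟨y₁, y₂⟩, e, hx, -, hyQ, hj, -, z, hz, hc⟩ := hL
    refine ⟨z, hz, Conn.trans ?_ (hc.mono hrest)⟩
    rw [mem_sqr] at hx
    simp only [Set.mem_ofPred_eq] at hyQ
    have hy : y₁ = -k - 1 ∧ -k ≤ y₂ ∧ y₂ ≤ k := by
      obtain ⟨⟨u, v⟩, d⟩ := e
      cases d <;> rcases hj with ⟨h1, h2⟩ | ⟨h1, h2⟩ <;>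
        simp only [grid_src, grid_tgt, gridTgt_true, gridTgt_false, Prod.ext_iff] at h1 h2 <;>
        omega
    obtain ⟨rfl, hy1, hy2⟩ := hy
    have hrow : grid.Conn K (-k - 1, y₂) (0, y₂) := conn_row (by omega) fun t h1 h2 =>
      hbrK _ (mem_bridges_h.2 (by omega))
    refine Conn.trans ?_ hrow.symm
    rcases le_total 0 y₂ with h | h
    · exact conn_col h fun t h1 h2 => hbrK _ (mem_bridges_v.2 (by omega))
    · exact (conn_col h fun t h1 h2 => hbrK _ (mem_bridges_v.2 (by omega))).symm
  -- the dual bonds available to the dual arms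
  set L : Set GridEdge := opn (dualCfg ω') \ {dualEdge e₀} with hLdef
  have hLmem : ∀ e, ω' e = false → e ≠ e₀ → dualEdge e ∈ L := by
    intro e he hne
    refine ⟨?_, fun h => hne (dualEdge.injective h)⟩
    change (!ω' (dualEdge.symm (dualEdge e))) = true
    rw [Equiv.symm_apply_apply, he]; rfl
  have hnbrL : ∀ e, e ∈ M → e ∉ bridges k → e ≠ e₀ → dualEdge e ∈ L := fun e he hn hne =>
    hLmem e (hnbr e he hn) hne
  -- the dual arms avoid the modified bonds: the faces `[-k - 1, k] × [-k - 1, k]` form a square with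
  -- the same centre as `[-k, k] × [-k, k]`, and they include the faces next to all bonds in `M`
  have hdM : ∀ e, e ∈ M → dualEdge e ∈ grid.touch (sqr (-k - 1) k : Set (ℤ × ℤ)) := by
    rintro ⟨⟨x, y⟩, d⟩ he
    rw [memM] at he
    cases d
    · rw [mem_touch_sqr_h (by omega)] at he
      rw [dualEdge_h, mem_touch_sqr_v (by omega)]; omega
    · rw [mem_touch_sqr_v (by omega)] at he
      rw [dualEdge_v, mem_touch_sqr_h (by omega)]; omega
  have hdrest : opn (dualCfg ω) \ grid.touch (sqr (-k - 1) k : Set (ℤ × ℤ)) ⊆ L := by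
    rintro d ⟨hd, hdt⟩
    rw [← dualEdge.apply_symm_apply d] at hdt ⊢
    have hdM' : dualEdge.symm d ∉ M := fun h => hdt (hdM _ h)
    refine hLmem _ ?_ fun h => hdM' (h ▸ he0M)
    rw [hout _ hdM']
    simpa [opn, dualCfg] using hd
  have htop : ∃ z, z ∉ sqr (-N - 1) N ∧ grid.Conn L (0, 0) z := by
    obtain ⟨x, ⟨y₁, y₂⟩, e, hx, -, hyQ, hj, he, z, hz, hc⟩ := hT
    refine ⟨z, hz, Conn.trans ?_ (hc.mono hdrest)⟩
    rw [mem_sqr] at hx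
    simp only [Set.mem_ofPred_eq] at hyQ
    have hy : (y₂ = k + 1 ∧ -k - 1 ≤ y₁ ∧ y₁ ≤ k) ∧ e = ((y₁, k), true) := by
      obtain ⟨⟨u, v⟩, d⟩ := e
      cases d <;> rcases hj with ⟨h1, h2⟩ | ⟨h1, h2⟩ <;>
        simp only [grid_src, grid_tgt, gridTgt_true, gridTgt_false, Prod.ext_iff,
          and_true, Bool.false_eq_true, and_false] at h1 h2 ⊢ <;>
        omega
    obtain ⟨⟨rfl, hy1, hy2⟩, rfl⟩ := hy
    have hspike : grid.Conn L (y₁, k) (y₁, k + 1) := by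
      refine (joins_v y₁ k).conn ?_
      have hnM : ((y₁, k + 1), false) ∉ M := by
        rw [memM, mem_touch_sqr_h (by omega)]; omega
      have := hLmem ((y₁, k + 1), false) (by
        rw [hout _ hnM]; simpa [dualCfg] using he) (fun h => hnM (h ▸ he0M))
      rwa [dualEdge_h, add_sub_cancel_right] at this
    have hcol : grid.Conn L (0, 0) (0, k) := conn_col (by omega) fun t h1 h2 => by
      have := hnbrL ((0, t + 1), false) (by rw [memM, mem_touch_sqr_h (by omega)]; omega)
        (by rw [mem_bridges_h]; omega) (by simp [he₀]; omega)
      rwa [dualEdge_h, add_sub_cancel_right] at this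
    refine (hcol.trans ?_).trans hspike
    have hrow : ∀ t, -k - 1 ≤ t → t < k → ((t, k), false) ∈ L := fun t h1 h2 => by
      have := hnbrL ((t + 1, k), true) (by rw [memM, mem_touch_sqr_v (by omega)]; omega)
        (by rw [mem_bridges_v]; omega) (by simp [he₀])
      rwa [dualEdge_v, add_sub_cancel_right] at this
    rcases le_total 0 y₁ with h | h
    · exact conn_row h fun t h1 h2 => hrow t (by omega) (by omega)
    · exact (conn_row h fun t h1 h2 => hrow t (by omega) (by omega)).symm
  have hbottom : ∃ z, z ∉ sqr (-N - 1) N ∧ grid.Conn L (0, -1) z := by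
    obtain ⟨x, ⟨y₁, y₂⟩, e, hx, -, hyQ, hj, he, z, hz, hc⟩ := hB
    refine ⟨z, hz, Conn.trans ?_ (hc.mono hdrest)⟩
    rw [mem_sqr] at hx
    simp only [Set.mem_ofPred_eq] at hyQ
    have hy : (y₂ = -k - 2 ∧ -k - 1 ≤ y₁ ∧ y₁ ≤ k) ∧ e = ((y₁, -k - 2), true) := by
      obtain ⟨⟨u, v⟩, d⟩ := e
      cases d <;> rcases hj with ⟨h1, h2⟩ | ⟨h1, h2⟩ <;>
        simp only [grid_src, grid_tgt, gridTgt_true, gridTgt_false, Prod.ext_iff,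
          and_true, Bool.false_eq_true, and_false] at h1 h2 ⊢ <;>
        omega
    obtain ⟨⟨rfl, hy1, hy2⟩, rfl⟩ := hy
    have hspike : grid.Conn L (y₁, -k - 2) (y₁, -k - 1) := by
      have hj := joins_v y₁ (-k - 2)
      rw [show -k - 2 + 1 = -k - 1 by ring] at hj
      refine hj.conn ?_
      have hnM : ((y₁, -k - 1), false) ∉ M := by
        rw [memM, mem_touch_sqr_h (by omega)]; omega
      have heq : -k - 2 + 1 = -k - 1 := by ring
      have := hLmem ((y₁, -k - 1), false) (by
        rw [hout _ hnM]; simpa [dualCfg, heq] using he) (fun h => hnM (h ▸ he0M))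
      rwa [dualEdge_h, show -k - 1 - 1 = -k - 2 by ring] at this
    have hcol : grid.Conn L (0, -k - 1) (0, -1) := conn_col (by omega) fun t h1 h2 => by
      have := hnbrL ((0, t + 1), false) (by rw [memM, mem_touch_sqr_h (by omega)]; omega)
        (by rw [mem_bridges_h]; omega) (by simp [he₀]; omega)
      rwa [dualEdge_h, add_sub_cancel_right] at this
    refine (hcol.symm.trans ?_).trans hspike.symm
    have hrow : ∀ t, -k - 1 ≤ t → t < k → ((t, -k - 1), false) ∈ L := fun t h1 h2 => by
      have := hnbrL ((t + 1, -k - 1), true) (by rw [memM, mem_touch_sqr_v (by omega)]; omega)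
        (by rw [mem_bridges_v]; omega) (by simp [he₀])
      rwa [dualEdge_v, add_sub_cancel_right] at this
    rcases le_total 0 y₁ with h | h
    · exact conn_row h fun t h1 h2 => hrow t (by omega) (by omega)
    · exact (conn_row h fun t h1 h2 => hrow t (by omega) (by omega)).symm
  obtain ⟨z₁, hz₁, hc₁⟩ := hleft
  obtain ⟨z₂, hz₂, hc₂⟩ := hright
  obtain ⟨z₃, hz₃, hc₃⟩ := htop
  obtain ⟨z₄, hz₄, hc₄⟩ := hbottom
  have hKeq : (opn ω' ∩ grid.touch (sqr (-N) N : Set (ℤ × ℤ))) \ {e₀} =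
      K ∩ grid.touch (sqr (-N) N : Set (ℤ × ℤ)) := by
    rw [hK, Set.inter_sdiff_right_comm]
  have hin : grid.touch (sqr (-N) N : Set (ℤ × ℤ)) ⊆
      grid.inside (sqr (-N - 1) (N + 1) : Set (ℤ × ℤ)) := by
    rintro ⟨⟨x, y⟩, d⟩ he
    cases d
    · rw [mem_touch_sqr_h (by omega)] at he
      simp only [inside, Set.mem_ofPred_eq, grid_src, grid_tgt, gridTgt_false, Finset.mem_coe,
        mem_sqr]
      omega
    · rw [mem_touch_sqr_v (by omega)] at he
      simp only [inside, Set.mem_ofPred_eq, grid_src, grid_tgt, gridTgt_true, Finset.mem_coe,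
        mem_sqr]
      omega
  have he0N : e₀ ∈ grid.touch (sqr (-N) N : Set (ℤ × ℤ)) := by
    rw [he₀, mem_touch_sqr_h (by omega)]; omega
  have hj0 : grid.Joins e₀ (0, 0) (1, 0) := by
    have := joins_h 0 0
    rwa [zero_add] at this
  have hjd : grid.Joins (dualEdge e₀) (0, 0) (0, -1) := by
    have := joins_v 0 (-1)
    rw [neg_add_cancel] at this
    exact this.symm
  refine ⟨(0, 0), (1, 0), hj0, ?_, ?_, ?_⟩
  · rw [hKeq]; exact hc₁.exit hz₁
  · rw [hKeq]; exact hc₂.exit hz₂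
  · rw [hKeq]
    refine not_conn_of_dual (L := L) (Set.inter_subset_right.trans hin) ?_ (fun h => h.1.2 rfl)
      (fun h => h.2 rfl) (hin he0N) hj0 hjd (z := z₃) (z' := z₄) ?_ ?_ hc₃.symm hc₄
    · rintro e ⟨⟨he, -⟩, -⟩ ⟨he', -⟩
      change (!ω' (dualEdge.symm (dualEdge e))) = true at he'
      rw [Equiv.symm_apply_apply, (he : ω' e = true)] at he'
      exact absurd he' (by simp)
    · rwa [add_sub_cancel_right]
    · rwa [add_sub_cancel_right]

open Filter Topology

/-! ### Exponential decay below `1 / 2` -/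

/-- The probability that the origin is joined to a vertex at distance more than `n`. -/
noncomputable def theta (p : unitInterval) (n : ℕ) : ℝ :=
  (bern GridEdge p).real (grid.Exit (ball 0 n : Set (ℤ × ℤ)) 0)

lemma mem_ball_shift (v : ℤ × ℤ) (n : ℤ) (u x : ℤ × ℤ) :
    (shift v).vert x ∈ ball (u + v) n ↔ x ∈ ball u n := by
  rw [mem_ball, mem_ball]
  simp only [shift, Equiv.coe_addRight, Prod.fst_add, Prod.snd_add]
  omega

lemma exit_ball (p : unitInterval) (v : ℤ × ℤ) (n : ℕ) :
    (bern GridEdge p).real (grid.Exit (ball v n : Set (ℤ × ℤ)) v) = theta p n := by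
  rw [theta, ← bern_reindex (dependsOn_exit_touchF (ball 0 (n : ℤ)) 0) p (shift v).edge]
  congr 1
  ext ω
  have h := (shift v).exit_iff (U := (ball 0 (n : ℤ) : Set (ℤ × ℤ)))
    (W := (ball v (n : ℤ) : Set (ℤ × ℤ)))
    (fun x => by simpa using mem_ball_shift v n 0 x) 0 ω
  have h0 : (shift v).vert 0 = v := by simp [shift]
  rw [h0] at h
  exact h.symm

lemma ball_mono {v w : ℤ × ℤ} {m n : ℤ} (h1 : w.1 - n ≤ v.1 - m) (h2 : v.1 + m ≤ w.1 + n)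
    (h3 : w.2 - n ≤ v.2 - m) (h4 : v.2 + m ≤ w.2 + n) : ball v m ⊆ ball w n := by
  intro x hx
  rw [mem_ball] at hx ⊢
  omega

lemma theta_anti (p : unitInterval) : Antitone (theta p) := by
  intro m n h
  refine measureReal_mono (exit_anti ?_ _) (measure_ne_top _ _)
  exact Finset.coe_subset.2 (ball_mono (by simpa) (by simpa) (by simpa) (by simpa))

lemma theta_nonneg (p : unitInterval) (n : ℕ) : 0 ≤ theta p n := measureReal_nonneg

lemma exists_ball_superset (S : Finset (ℤ × ℤ)) : ∃ L : ℕ, S ⊆ ball 0 (L : ℤ) := by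
  refine ⟨S.sup fun v => v.1.natAbs + v.2.natAbs, fun v hv => ?_⟩
  have := Finset.le_sup (f := fun v : ℤ × ℤ => v.1.natAbs + v.2.natAbs) hv
  rw [mem_ball]
  simp only [Prod.fst_zero, Prod.snd_zero]
  omega

/-- If `φ_p(S) < 1` for some finite `S`, then the one-arm probabilities decay exponentially. -/
lemma tendsto_mul_theta {p : unitInterval} {S : Finset (ℤ × ℤ)} (h0 : 0 ∈ S)
    (hphi : grid.phi p S 0 < 1) : Tendsto (fun n : ℕ => n * theta p n) atTop (𝓝 0) := by
  obtain ⟨L, hL⟩ := exists_ball_superset S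
  set q := grid.phi p S 0 with hq
  have hq0 : 0 ≤ q := mul_nonneg p.2.1 (Finset.sum_nonneg fun _ _ => measureReal_nonneg)
  have step : ∀ n : ℕ, theta p (n + (L + 1)) ≤ q * theta p n := by
    intro n
    refine exit_le_phi_mul p h0 (hL.trans ?_) (theta_nonneg p n) ?_
    · refine ball_mono ?_ ?_ ?_ ?_ <;> simp only [Prod.fst_zero, Prod.snd_zero] <;> omega
    · intro x y e hx _ hj
      rw [← exit_ball p y n]
      refine measureReal_mono (exit_anti ?_ _) (measure_ne_top _ _)
      have hx' := mem_ball.1 (hL hx)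
      simp only [Prod.fst_zero, Prod.snd_zero] at hx'
      have hy : (-(L : ℤ) - 1 ≤ y.1 ∧ y.1 ≤ L + 1) ∧ -(L : ℤ) - 1 ≤ y.2 ∧ y.2 ≤ L + 1 := by
        obtain ⟨⟨u, v⟩, d⟩ := e
        cases d <;> rcases hj with ⟨h1, h2⟩ | ⟨h1, h2⟩ <;>
          simp only [grid_src, grid_tgt, gridTgt_true, gridTgt_false, Prod.ext_iff] at h1 h2 <;>
          omega
      refine Finset.coe_subset.2 (ball_mono ?_ ?_ ?_ ?_) <;>
        simp only [Prod.fst_zero, Prod.snd_zero] <;> omega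
  have hpow : ∀ j : ℕ, theta p (j * (L + 1)) ≤ q ^ j := by
    intro j
    induction j with
    | zero =>
      rw [zero_mul, pow_zero]
      exact measureReal_le_one
    | succ j ih =>
      rw [Nat.succ_mul, pow_succ']
      exact (step _).trans (mul_le_mul_of_nonneg_left ih hq0)
  have hlim : Tendsto (fun j : ℕ => (L + 1 : ℝ) * (j * q ^ j + q ^ j)) atTop (𝓝 0) := by
    have := ((tendsto_self_mul_const_pow_of_lt_one hq0 hphi).add
      (tendsto_pow_atTop_nhds_zero_of_lt_one hq0 hphi)).const_mul (L + 1 : ℝ)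
    simpa using this
  refine squeeze_zero (fun n => mul_nonneg (Nat.cast_nonneg n) (theta_nonneg p n)) (fun n => ?_)
    (hlim.comp (Nat.tendsto_div_const_atTop (Nat.succ_ne_zero L)))
  simp only [Function.comp]
  set j := n / (L + 1) with hj
  have h1 : theta p n ≤ q ^ j := (theta_anti p (Nat.div_mul_le_self n (L + 1))).trans (hpow j)
  have h2 : (n : ℝ) ≤ (L + 1) * (j + 1) := by
    have : n ≤ (L + 1) * (j + 1) := by
      have := Nat.div_add_mod n (L + 1)
      have h3 := Nat.mod_lt n (show 0 < L + 1 by omega)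
      rw [← hj] at this
      rw [Nat.mul_add]
      omega
    exact_mod_cast this
  calc n * theta p n ≤ ((L + 1) * (j + 1)) * q ^ j :=
        mul_le_mul h2 h1 (theta_nonneg p n) (by positivity)
    _ = _ := by ring

/-- If the one-arm probabilities do not tend to zero, then large squares are joined to far away with
probability close to one. The origin may be replaced by many distant vertices, for which the events
of an exit from a ball of a moderate radius `r` are independent, while an exit from such a ball
extends to an exit from a much larger ball with high conditional probability. -/
lemma exists_setExit_ge {p : unitInterval} {c : ℝ} (hc : 0 < c) (hth : ∀ n, c ≤ theta p n) {ε : ℝ}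
    (hε : 0 < ε) : ∃ k : ℕ, ∀ N : ℕ, 1 - ε ≤
      (bern GridEdge p).real (SetExit (ball 0 k : Set (ℤ × ℤ)) (ball 0 N : Set (ℤ × ℤ))) := by
  have hc1 : c ≤ 1 := (hth 0).trans measureReal_le_one
  obtain ⟨m, hm⟩ := exists_pow_lt_of_lt_one (half_pos hε) (show 1 - c < 1 by linarith)
  have hbdd : BddBelow (Set.range (theta p)) := ⟨0, by rintro _ ⟨n, rfl⟩; exact theta_nonneg p n⟩
  obtain ⟨r, hr⟩ : ∃ r, theta p r < (⨅ n, theta p n) + ε / (2 * (m + 1)) :=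
    exists_lt_of_ciInf_lt (lt_add_of_pos_right _ (by positivity))
  have hr' : ∀ R, theta p r - theta p R ≤ ε / (2 * (m + 1)) := fun R => by
    have := ciInf_le hbdd R; linarith
  set pt : ℕ → ℤ × ℤ := fun i => (i * (2 * r + 3), 0) with hpt
  refine ⟨m * (2 * r + 3), fun N => ?_⟩
  set k := m * (2 * r + 3) with hk
  set R := r + N + k with hR
  set A : ℕ → Set (GridEdge → Bool) := fun i => grid.Exit (ball (pt i) R : Set (ℤ × ℤ)) (pt i)
    with hA
  set B : ℕ → Set (GridEdge → Bool) := fun i => grid.Exit (ball (pt i) r : Set (ℤ × ℤ)) (pt i)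
    with hB
  have hAB : ∀ i, A i ⊆ B i := fun i => exit_anti (Finset.coe_subset.2
    (ball_mono (by omega) (by omega) (by omega) (by omega))) _
  have hBdep : ∀ i, DependsOn (· ∈ B i) (grid.touchF (ball (pt i) r) : Set GridEdge) := fun i =>
    dependsOn_exit_touchF _ _
  have hAdep : ∀ i, DependsOn (· ∈ A i) (grid.touchF (ball (pt i) R) : Set GridEdge) := fun i =>
    dependsOn_exit_touchF _ _
  have hdisj : Pairwise fun i j => Disjoint (grid.touchF (ball (pt i) r))
      (grid.touchF (ball (pt j) r)) := by
    intro i j hij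
    rw [Finset.disjoint_left]
    rintro ⟨⟨x, y⟩, d⟩ h1 h2
    have key : ∀ i, (((x, y), d) : GridEdge) ∈ grid.touchF (ball (pt i) r) →
        (i * (2 * r + 3) : ℤ) - r - 1 ≤ x ∧ x ≤ (i * (2 * r + 3) : ℤ) + r := by
      intro i h
      rw [mem_touchF] at h
      cases d <;> simp only [touch, Set.mem_ofPred_eq, grid_src, grid_tgt, gridTgt_true,
        gridTgt_false, Finset.mem_coe, mem_ball, hpt] at h <;> omega
    have h3 := key i h1
    have h4 := key j h2
    rcases lt_or_gt_of_ne hij with h | h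
    · have : ((i : ℤ) + 1) * (2 * r + 3) ≤ j * (2 * r + 3) :=
        mul_le_mul_of_nonneg_right (by omega) (by omega)
      linarith
    · have : ((j : ℤ) + 1) * (2 * r + 3) ≤ i * (2 * r + 3) :=
        mul_le_mul_of_nonneg_right (by omega) (by omega)
      linarith
  have hnone : (bern GridEdge p).real (⋂ i ∈ Finset.range m, (B i)ᶜ) ≤ ε / 2 := by
    rw [bern_iInter_indep _ hdisj fun i => dependsOn_compl (hBdep i)]
    have : ∀ i ∈ Finset.range m, (bern GridEdge p).real (B i)ᶜ = 1 - theta p r := fun i _ => by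
      rw [bern_compl (hBdep i), exit_ball]
    rw [Finset.prod_congr rfl this, Finset.prod_const, Finset.card_range]
    have h1 : theta p r ≤ 1 := measureReal_le_one
    exact (pow_le_pow_left₀ (by linarith) (by linarith [hth r]) m).trans hm.le
  have hdiff : ∀ i ∈ Finset.range m, (bern GridEdge p).real (B i \ A i) ≤ ε / (2 * (m + 1)) := by
    intro i _
    rw [measureReal_sdiff (hAB i) (measurableSet_of_dependsOn (hAdep i)), exit_ball, exit_ball]
    exact hr' R
  have hcover : (Set.univ : Set (GridEdge → Bool)) ⊆
      SetExit (ball 0 k : Set (ℤ × ℤ)) (ball 0 N : Set (ℤ × ℤ)) ∪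
        ((⋂ i ∈ Finset.range m, (B i)ᶜ) ∪ ⋃ i ∈ Finset.range m, B i \ A i) := by
    intro ω _
    by_cases h : ∃ i ∈ Finset.range m, ω ∈ A i
    · obtain ⟨i, hi, hω⟩ := h
      have hi' : (i * (2 * r + 3) : ℤ) ≤ k := by
        have : i * (2 * r + 3) ≤ k := Nat.mul_le_mul_right _ (Finset.mem_range.1 hi).le
        exact_mod_cast this
      have hi0 : (0 : ℤ) ≤ i * (2 * r + 3) := by positivity
      refine Or.inl ⟨pt i, ?_, exit_anti (Finset.coe_subset.2 (ball_mono ?_ ?_ ?_ ?_)) _ hω⟩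
      · rw [Finset.mem_coe, mem_ball]
        simp only [hpt, Prod.fst_zero, Prod.snd_zero]
        omega
      all_goals simp only [hpt, Prod.fst_zero, Prod.snd_zero]; omega
    · push Not at h
      by_cases h' : ∃ i ∈ Finset.range m, ω ∈ B i
      · obtain ⟨i, hi, hω⟩ := h'
        exact Or.inr (Or.inr (Set.mem_biUnion (Finset.mem_coe.2 hi) ⟨hω, h i hi⟩))
      · push Not at h'
        exact Or.inr (Or.inl (Set.mem_iInter₂.2 h'))
  have h1 := (measureReal_mono hcover (measure_ne_top (bern GridEdge p) _)).trans
    ((measureReal_union_le _ _).trans (add_le_add_right (measureReal_union_le _ _) _))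
  rw [probReal_univ] at h1
  have h2 : (bern GridEdge p).real (⋃ i ∈ Finset.range m, B i \ A i) ≤ ε / 2 := by
    refine (measureReal_biUnion_finset_le _ _).trans ((Finset.sum_le_sum hdiff).trans ?_)
    rw [Finset.sum_const, Finset.card_range, nsmul_eq_mul, mul_div_assoc', div_le_div_iff₀
      (by positivity) (by norm_num)]
    nlinarith
  linarith

/-- If arms are not rare at `p₁`, then for `p` between `p₁` and `1 - p₁` the two-arm probabilities at
a given bond are bounded below. -/
lemma exists_twoArm_ge {p₁ : unitInterval} (hp₁ : 0 < (p₁ : ℝ)) {c : ℝ} (hc : 0 < c)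
    (hth : ∀ n, c ≤ theta p₁ n) :
    ∃ c' : ℝ, 0 < c' ∧ ∃ k : ℕ, ∀ N : ℕ, k ≤ N → ∀ p : unitInterval, p₁ ≤ p →
      p₁ ≤ unitInterval.symm p → c' ≤ (bern GridEdge p).real
        (grid.TwoArm (ball 0 N : Set (ℤ × ℤ)) ((0, 0), false)) := by
  obtain ⟨k₀, hk₀⟩ := exists_setExit_ge hc hth (show (0 : ℝ) < (1 / 8) ^ 4 by norm_num)
  set k := k₀ + 1 with hk
  set M := grid.touchF (sqr (-k) k) with hM
  refine ⟨(p₁ : ℝ) ^ M.card * (1 / 2), by positivity, k, fun N hN p hp hp' => ?_⟩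
  have hsub : ∀ {a b : ℤ}, a ≤ -k₀ → k₀ ≤ b → (ball 0 k₀ : Finset (ℤ × ℤ)) ⊆ sqr a b := by
    intro a b ha hb x hx
    rw [ball_zero, mem_sqr] at hx
    rw [mem_sqr]; omega
  have hsub' : ∀ {a b : ℤ} {n : ℕ}, -n ≤ a → b ≤ n → sqr a b ⊆ (ball 0 n : Finset (ℤ × ℤ)) := by
    intro a b n ha hb x hx
    rw [mem_sqr] at hx
    rw [ball_zero, mem_sqr]; omega
  have hmono : ∀ (q : unitInterval), p₁ ≤ q → ∀ {a b A B : ℤ} {n : ℕ}, a ≤ -k₀ → k₀ ≤ b →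
      -n ≤ A → B ≤ n → 1 - (1 / 8 : ℝ) ^ 4 ≤
        (bern GridEdge q).real (SetExit (sqr a b) (sqr A B : Set (ℤ × ℤ))) := by
    intro q hq a b A B n ha hb hA hB
    refine (hk₀ n).trans ((bern_mono (dependsOn_setExit _ _) (isUpperSet_setExit _ _) hq).trans
      (measureReal_mono ?_ (measure_ne_top _ _)))
    rintro ω ⟨x, hx, he⟩
    exact ⟨x, hsub ha hb hx, exit_anti (Finset.coe_subset.2 (hsub' hA hB)) _ he⟩
  -- each of the four arms is missing with probability at most `1 / 8`
  have hprim := sideArm_bound p (a := -k) (b := k) (A := -N) (B := N) (by ring) (by omega)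
    (by omega) (hmono p hp (n := N) (by omega) (by omega) (by omega) (by omega))
  have hdual := sideArm_bound (unitInterval.symm p) (a := -k - 1) (b := k) (A := -N - 1) (B := N)
    (by ring) (by omega) (by omega)
    (hmono _ hp' (n := N + 1) (by omega) (by omega) (by push_cast; omega) (by push_cast; omega))
  have hs1 : sqr (-(k : ℤ)) k ⊆ sqr (-N) N := by
    intro x hx; rw [mem_sqr] at hx ⊢; omega
  have hs2 : sqr (-(k : ℤ) - 1) k ⊆ sqr (-N - 1) N := by
    intro x hx; rw [mem_sqr] at hx ⊢; omega
  have hd1 := fun Q => dependsOn_sideArm hs1 Q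
  have hd2 := fun Q => dependsOn_sideArm hs2 Q
  obtain ⟨hR, -, hL, -⟩ := hprim
  obtain ⟨-, hT, -, hB⟩ := hdual
  rw [← bern_not_reindex (hd2 _) p dualEdge.symm] at hT hB
  set AR := SideArm (-k) k (sqr (-N) N : Set (ℤ × ℤ)) {v | (k : ℤ) < v.1} with hAR
  set AL := SideArm (-k) k (sqr (-N) N : Set (ℤ × ℤ)) {v | v.1 < -(k : ℤ)} with hAL
  set AT := {ω : GridEdge → Bool | (fun e => !ω (dualEdge.symm e)) ∈
    SideArm (-k - 1) k (sqr (-N - 1) N : Set (ℤ × ℤ)) {v | (k : ℤ) < v.2}} with hAT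
  set AB := {ω : GridEdge → Bool | (fun e => !ω (dualEdge.symm e)) ∈
    SideArm (-k - 1) k (sqr (-N - 1) N : Set (ℤ × ℤ)) {v | v.2 < -(k : ℤ) - 1}} with hAB
  set Z := modify M (bridges k) ⁻¹' grid.TwoArm (ball 0 N : Set (ℤ × ℤ)) ((0, 0), false) with hZ
  have hmR : MeasurableSet AR := measurableSet_of_dependsOn (hd1 _)
  have hmL : MeasurableSet AL := measurableSet_of_dependsOn (hd1 _)
  have hmeas : Measurable fun (ω : GridEdge → Bool) e => !ω (dualEdge.symm e) :=
    measurable_pi_lambda _ fun e =>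
      (measurable_of_countable Bool.not).comp (measurable_pi_apply _)
  have hmT : MeasurableSet AT := hmeas (measurableSet_of_dependsOn (hd2 _))
  have hmB : MeasurableSet AB := hmeas (measurableSet_of_dependsOn (hd2 _))
  have hcover : (Set.univ : Set (GridEdge → Bool)) ⊆ Z ∪ ((ARᶜ ∪ ALᶜ) ∪ (ATᶜ ∪ ABᶜ)) := by
    intro ω _
    by_cases h : ω ∈ AR ∧ ω ∈ AL ∧ ω ∈ AT ∧ ω ∈ AB
    · left
      rw [hZ, Set.mem_preimage, ball_zero]
      exact twoArm_of_four_arms (by omega) (by omega) h.1 h.2.1 h.2.2.1 h.2.2.2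
    · right
      simp only [Set.mem_union, Set.mem_compl_iff]
      tauto
  have h1 := (measureReal_mono hcover (measure_ne_top (bern GridEdge p) _)).trans
    ((measureReal_union_le _ _).trans (add_le_add_right ((measureReal_union_le _ _).trans
      (add_le_add (measureReal_union_le _ _) (measureReal_union_le _ _))) _))
  rw [probReal_univ, probReal_compl_eq_one_sub hmR, probReal_compl_eq_one_sub hmL,
    probReal_compl_eq_one_sub hmT, probReal_compl_eq_one_sub hmB] at h1
  have hZ2 : 1 / 2 ≤ (bern GridEdge p).real Z := by linarith
  have hdep : DependsOn (· ∈ grid.TwoArm (ball 0 (N : ℤ) : Set (ℤ × ℤ)) ((0, 0), false))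
      (grid.touchF (ball 0 N) : Set GridEdge) := by
    rw [coe_touchF]; exact dependsOn_twoArm _ _
  have hp'' : (p₁ : ℝ) ≤ 1 - p := by
    have := Subtype.coe_le_coe.2 hp'
    rwa [unitInterval.coe_symm_eq] at this
  refine le_trans ?_ (modify_le hdep (bridges k) (Finset.filter_subset _ _) p hp₁.le
    (Subtype.coe_le_coe.2 hp) hp'')
  exact mul_le_mul_of_nonneg_left hZ2 (by positivity)

lemma card_ball (n : ℕ) : (ball 0 (n : ℤ)).card = (2 * n + 1) ^ 2 := by
  simp only [ball, Finset.card_product, Int.card_Icc, Prod.fst_zero, Prod.snd_zero]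
  rw [pow_two]
  congr 1 <;> omega

/-- The two-arm probabilities at a bond cannot be bounded below uniformly in the distance, over an
interval of parameters: the number of bonds in a ball would outgrow the number of clusters that meet
its boundary. -/
lemma twoArm_not_bounded_below {p₁ p₂ : unitInterval} (h12 : p₁ < p₂) {c : ℝ} (hc : 0 < c)
    (k : ℕ) (h : ∀ N : ℕ, k ≤ N → ∀ p : unitInterval, p₁ ≤ p → p ≤ p₂ →
      c ≤ (bern GridEdge p).real (grid.TwoArm (ball 0 N : Set (ℤ × ℤ)) ((0, 0), false))) :
    False := by
  classical
  have hd : 0 < (p₂ - p₁ : ℝ) := sub_pos.2 h12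
  obtain ⟨n₀, hn₀⟩ := exists_nat_gt (8 / (c * (p₂ - p₁)))
  set n := max n₀ k with hn
  have hkn : k ≤ 2 * n := by omega
  have hcount := twoArm_sum_le (G := grid) (U := ball 0 (n : ℤ))
    (B := ball 0 ((n + 1 : ℕ) : ℤ) \ ball 0 (n : ℤ)) (by
      rintro ⟨⟨u, v⟩, d⟩ he x y hj hx
      refine Finset.mem_sdiff.2 ⟨?_, hx⟩
      rw [ball_zero] at he
      rw [ball_zero, mem_sqr]
      push_cast
      cases d
      · rw [mem_touch_sqr_h (by omega)] at he
        rcases hj with ⟨rfl, rfl⟩ | ⟨rfl, rfl⟩ <;>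
          simp only [grid_src, grid_tgt, gridTgt_false] <;> omega
      · rw [mem_touch_sqr_v (by omega)] at he
        rcases hj with ⟨rfl, rfl⟩ | ⟨rfl, rfl⟩ <;>
          simp only [grid_src, grid_tgt, gridTgt_true] <;> omega)
    h12.le (m := (2 * n + 1 : ℝ) ^ 2 * c) (by
      intro p hp1 hp2
      -- `ball v (2 * n)` contains `ball 0 n`, so that two arms out of the former give two arms out
      -- of the latter
      have hone : ∀ v ∈ ball 0 (n : ℤ), c ≤ (bern GridEdge p).real
          (grid.TwoArm (ball 0 n : Set (ℤ × ℤ)) (v, false)) := by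
        intro v hv
        have hdep : DependsOn (· ∈ grid.TwoArm (ball 0 ((2 * n : ℕ) : ℤ) : Set (ℤ × ℤ))
            ((0, 0), false)) (grid.touchF (ball 0 ((2 * n : ℕ) : ℤ)) : Set GridEdge) := by
          rw [coe_touchF]; exact dependsOn_twoArm _ _
        refine (h (2 * n) hkn p hp1 hp2).trans ?_
        rw [← bern_reindex hdep p (shift v).edge]
        refine measureReal_mono (fun ω hω => ?_) (measure_ne_top _ _)
        have h1 := ((shift v).twoArm_iff (U := (ball 0 ((2 * n : ℕ) : ℤ) : Set (ℤ × ℤ)))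
          (W := (ball v ((2 * n : ℕ) : ℤ) : Set (ℤ × ℤ)))
          (fun x => by simpa using mem_ball_shift v ((2 * n : ℕ) : ℤ) 0 x)
          ((0, 0), false) ω).1 hω
        have h2 : (shift v).edge ((0, 0), false) = (v, false) := by
          simp [shift]
        rw [h2] at h1
        rw [mem_ball] at hv
        simp only [Prod.fst_zero, Prod.snd_zero] at hv
        refine twoArm_mono (Finset.coe_subset.2 (ball_mono ?_ ?_ ?_ ?_)) _ h1 <;>
          simp only [Prod.fst_zero, Prod.snd_zero] <;> push_cast <;> omega
      have himg : (ball 0 (n : ℤ)).image (fun v => ((v, false) : GridEdge)) ⊆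
          grid.touchF (ball 0 (n : ℤ)) := by
        intro e he
        obtain ⟨v, hv, rfl⟩ := Finset.mem_image.1 he
        exact mem_touchF.2 (Or.inl hv)
      refine le_trans ?_ (Finset.sum_le_sum_of_subset_of_nonneg himg
        fun _ _ _ => measureReal_nonneg)
      rw [Finset.sum_image fun _ _ _ _ h => (Prod.ext_iff.1 h).1]
      refine le_trans (le_of_eq ?_) (Finset.card_nsmul_le_sum _ _ c hone)
      rw [card_ball, nsmul_eq_mul]
      push_cast; ring)
  have hsub : ball 0 (n : ℤ) ⊆ ball 0 ((n + 1 : ℕ) : ℤ) := by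
    refine ball_mono ?_ ?_ ?_ ?_ <;> push_cast <;> simp
  rw [Finset.card_sdiff_of_subset hsub, card_ball, card_ball] at hcount
  -- the boundary of the ball has `8 * n + 8` vertices
  have hcard : (((2 * (n + 1) + 1) ^ 2 - (2 * n + 1) ^ 2 : ℕ) : ℝ) = 8 * n + 8 := by
    have : (2 * (n + 1) + 1) ^ 2 - (2 * n + 1) ^ 2 = 8 * n + 8 := by
      have : (2 * (n + 1) + 1) ^ 2 = (8 * n + 8) + (2 * n + 1) ^ 2 := by ring
      rw [this, Nat.add_sub_cancel]
    rw [this]; push_cast; ring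
  rw [hcard] at hcount
  have hn1 : 8 / (c * (p₂ - p₁)) < (n : ℝ) :=
    hn₀.trans_le (Nat.cast_le.2 (le_max_left _ _))
  rw [div_lt_iff₀ (by positivity)] at hn1
  have hn0 : (0 : ℝ) ≤ n := Nat.cast_nonneg n
  nlinarith [mul_pos hc hd]

/-- Below `1 / 2` some finite set has a boundary functional less than one. -/
lemma exists_phi_lt_one {p : unitInterval} (hp : (p : ℝ) < 1 / 2) :
    ∃ S : Finset (ℤ × ℤ), 0 ∈ S ∧ grid.phi p S 0 < 1 := by
  by_contra hcon
  push Not at hcon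
  have hp0 := p.2.1
  set p₁ : unitInterval := ⟨(p + 1 / 2) / 2, by constructor <;> linarith⟩ with hp₁
  set p₂ : unitInterval := ⟨1 / 2, by norm_num, by norm_num⟩ with hp₂
  have h01 : p < p₁ := by
    rw [← Subtype.coe_lt_coe]; simp only [hp₁]; linarith
  have h12 : p₁ < p₂ := by
    rw [← Subtype.coe_lt_coe]; simp only [hp₁, hp₂]; linarith
  have hexp : Real.exp (-(p₁ - p : ℝ)) < 1 := by
    rw [Real.exp_lt_one_iff]
    have : (p : ℝ) < p₁ := h01
    linarith
  obtain ⟨c', hc', k, hk⟩ := exists_twoArm_ge (p₁ := p₁) (by simp only [hp₁]; linarith)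
    (sub_pos.2 hexp) fun n => exit_lower_bound h01.le
      (by rw [mem_ball]; simp) hcon
  refine twoArm_not_bounded_below h12 hc' k fun N hN q hq1 hq2 => hk N hN q hq1 ?_
  refine (h12.le.trans ?_)
  rw [← Subtype.coe_le_coe, unitInterval.coe_symm_eq]
  have : (q : ℝ) ≤ 1 / 2 := hq2
  simp only [hp₂]
  linarith

/-! ### Crossings of rectangles -/

lemma gridTgt_adj (e : GridEdge) : squareLattice.Adj e.1 (gridTgt e) := by
  obtain ⟨v, d⟩ := e
  cases d <;> simp [squareLattice]

/-- The bond with the given coordinates. -/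
def toBond (e : GridEdge) : Bond := ⟨s(e.1, gridTgt e), gridTgt_adj e⟩

lemma exists_joins_of_adj {v w : ℤ × ℤ} (h : squareLattice.Adj v w) : ∃ e, grid.Joins e v w := by
  obtain ⟨x, y⟩ := v
  obtain ⟨x', y'⟩ := w
  simp only [squareLattice] at h
  have h' : (x' = x + 1 ∧ y' = y) ∨ (x = x' + 1 ∧ y = y') ∨ (x' = x ∧ y' = y + 1) ∨
      (x = x' ∧ y = y' + 1) := by
    rcases abs_cases (x - x') with ⟨h1, _⟩ | ⟨h1, _⟩ <;>
      rcases abs_cases (y - y') with ⟨h2, _⟩ | ⟨h2, _⟩ <;> rw [h1, h2] at h <;> omega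
  rcases h' with ⟨rfl, rfl⟩ | ⟨rfl, rfl⟩ | ⟨rfl, rfl⟩ | ⟨rfl, rfl⟩
  · exact ⟨_, joins_h _ _⟩
  · exact ⟨_, (joins_h _ _).symm⟩
  · exact ⟨_, joins_v _ _⟩
  · exact ⟨_, (joins_v _ _).symm⟩

lemma toBond_bijective : Function.Bijective toBond := by
  constructor
  · rintro ⟨⟨x, y⟩, d⟩ ⟨⟨x', y'⟩, d'⟩ h
    have h' : s((x, y), gridTgt ((x, y), d)) = s((x', y'), gridTgt ((x', y'), d')) :=
      congrArg Subtype.val h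
    rw [Sym2.eq_iff] at h'
    cases d <;> cases d' <;>
      simp only [gridTgt_true, gridTgt_false, Prod.ext_iff, and_true, reduceCtorEq, and_false]
        at h' ⊢ <;> omega
  · rintro ⟨e, he⟩
    induction e using Sym2.ind with
    | _ v w =>
      obtain ⟨e, hj⟩ := exists_joins_of_adj (SimpleGraph.mem_edgeSet _ |>.1 he)
      refine ⟨e, Subtype.ext ?_⟩
      rcases hj with ⟨rfl, rfl⟩ | ⟨rfl, rfl⟩
      · rfl
      · exact Sym2.eq_swap

/-- The bonds of the square lattice are labelled by their coordinates. -/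
noncomputable def bondEquiv : GridEdge ≃ Bond := Equiv.ofBijective toBond toBond_bijective

lemma exists_walk {ω : Config} {R : Set (ℤ × ℤ)} {v w : ℤ × ℤ} (hv : v ∈ R)
    (h : grid.Conn (opn (fun e => ω (bondEquiv e)) ∩ grid.inside R) v w) :
    ∃ q : squareLattice.Walk v w, (∀ x ∈ q.support, x ∈ R) ∧
      ∀ e : Bond, (e : Sym2 (ℤ × ℤ)) ∈ q.edges → ω e = true := by
  induction h with
  | refl => exact ⟨.nil, by simpa using hv, by simp⟩
  | @tail u w _ h ih =>
    obtain ⟨q, hq, hq'⟩ := ih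
    obtain ⟨e, ⟨he, heR⟩, hj⟩ := h
    have heq : ((bondEquiv e : Bond) : Sym2 (ℤ × ℤ)) = s(u, w) := by
      rcases hj with ⟨rfl, rfl⟩ | ⟨rfl, rfl⟩
      · rfl
      · exact Sym2.eq_swap
    have hadj : squareLattice.Adj u w := by
      rw [← SimpleGraph.mem_edgeSet, ← heq]; exact (bondEquiv e).2
    refine ⟨q.concat hadj, fun x hx => ?_, fun f hf => ?_⟩
    · rw [SimpleGraph.Walk.support_concat, List.mem_append,
        List.mem_singleton] at hx
      rcases hx with hx | rfl
      · exact hq x hx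
      · exact (hj.mem_inside.1 heR).2
    · rw [SimpleGraph.Walk.edges_concat, List.concat_eq_append, List.mem_append,
        List.mem_singleton] at hf
      rcases hf with hf | hf
      · exact hq' f hf
      · have : f = bondEquiv e := Subtype.ext (hf.trans heq.symm)
        rw [this]; exact he

/-- A rectangle without a horizontal crossing has an open dual path from top to bottom, hence a long
dual arm from one of the faces at the top. -/
lemma one_sub_le_crossing (p : unitInterval) {R : Rectangle} {n : ℕ} (hn : 1 ≤ n)
    (hR : R.HasSize (3 * n) n) :
    1 - 3 * (n * theta (unitInterval.symm p) n) ≤ (percMeasure p).real R.horizontalCrossing := by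
  have hμ : percMeasure p = bern Bond p := rfl
  obtain ⟨h1, h2⟩ := hR
  push_cast at h1
  set D : ℤ → Set Config := fun i => {ω | (fun e => !ω ((dualEdge.symm.trans bondEquiv) e)) ∈
    grid.Exit (ball (i, R.d) n : Set (ℤ × ℤ)) (i, R.d)} with hD
  have hDm : ∀ i, (bern Bond p).real (D i) = theta (unitInterval.symm p) n := fun i => by
    rw [hD, bern_not_reindex (dependsOn_exit_touchF _ _), exit_ball]
  have hcover : (Set.univ : Set Config) ⊆
      R.horizontalCrossing ∪ ⋃ i ∈ Finset.Ico R.a R.b, D i := by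
    intro ω _
    by_cases hcr : ∃ v w, v.1 = R.a ∧ w.1 = R.b ∧ v ∈ R.verts ∧
        grid.Conn (opn (fun e => ω (bondEquiv e)) ∩ grid.inside R.verts) v w
    · left
      obtain ⟨v, w, hv, hw, hvR, hc⟩ := hcr
      obtain ⟨q, hq, hq'⟩ := exists_walk hvR hc
      classical
      exact ⟨v, w, q.bypass, q.bypass_isPath, hv, hw,
        fun x hx => hq x (q.support_bypass_subset_support hx),
        fun e he => hq' e (q.edges_bypass_subset_edges he)⟩
    · right
      push Not at hcr
      obtain ⟨i, j, hi, hib, hc⟩ := exists_dual_crossing (a := R.a) (b := R.b) (l := R.c)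
        (u := R.d) (by omega) (by omega) (fun e => ω (bondEquiv e))
        fun v w hv hw hvR => hcr v w hv hw hvR
      refine Set.mem_biUnion (Finset.mem_coe.2 (Finset.mem_Ico.2 ⟨hi, hib⟩)) ⟨(j, R.c - 1), ?_, hc⟩
      rw [Finset.mem_coe, mem_ball]
      simp only
      omega
  have h3 := (measureReal_mono hcover (measure_ne_top (bern Bond p) _)).trans
    ((measureReal_union_le _ _).trans (add_le_add_right (measureReal_biUnion_finset_le _ _) _))
  have hcard : (Finset.Ico R.a R.b).card = 3 * n := by
    rw [Int.card_Ico]; omega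
  rw [probReal_univ, Finset.sum_congr rfl fun i _ => hDm i, Finset.sum_const, hcard,
    nsmul_eq_mul] at h3
  push_cast at h3
  rw [hμ]
  linarith

end BondPercolation

theorem lemma2 (p : unitInterval) (hp : (1 / 2 : ℝ) < (p : ℝ))
    (R : ℕ → BondPercolation.Rectangle) (hR : ∀ n : ℕ, (R n).HasSize (3 * n) n) :
    Filter.Tendsto
      (fun n : ℕ => (BondPercolation.percMeasure p).real (R n).horizontalCrossing)
      Filter.atTop (nhds (1 : ℝ)) := by
  obtain ⟨S, h0, hS⟩ := BondPercolation.exists_phi_lt_one (p := unitInterval.symm p) (by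
    rw [unitInterval.coe_symm_eq]; linarith)
  have hlim := ((BondPercolation.tendsto_mul_theta h0 hS).const_mul 3).const_sub 1
  rw [mul_zero, sub_zero] at hlim
  refine tendsto_of_tendsto_of_tendsto_of_le_of_le' hlim tendsto_const_nhds ?_ ?_
  · filter_upwards [Filter.eventually_ge_atTop 1] with n hn
    exact BondPercolation.one_sub_le_crossing p hn (hR n)
  · have : MeasureTheory.IsProbabilityMeasure (BondPercolation.percMeasure p) :=
      inferInstanceAs (MeasureTheory.IsProbabilityMeasure
        (BondPercolation.bern BondPercolation.Bond p))
    exact Filter.Eventually.of_forall fun n => MeasureTheory.measureReal_le_one
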